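/- For a finite set $P$ of points in the plane in general position (no three collinear), let $\overline{\mathrm{cr}}(P)$ be the number of crossings (unordered pairs of crossing edges) in the complete geometric graph with vertex set $P$, whose edges are the straight line segments joining the pairs of points of $P$. Let $\overline{\mathrm{cr}}(K_n)$, the rectilinear crossing number of $K_n$, be the minimum of $\overline{\mathrm{cr}}(P)$ over all sets $P$ of $n$ points in general position in the plane. Then the rectilinear crossing number constant $$q_* := \lim_{n\to\infty} \frac{\overline{\mathrm{cr}}(K_n)}{\binom{n}{4}}$$ exists and satisfies $$q_* \le \frac{83247328}{218791125} < 0.380488 .$$ -/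

import Mathlib

open Filter Topology

/-- The Euclidean plane. -/
abbrev Plane : Type := EuclideanSpace ℝ (Fin 2)

/-- A finite point set in the plane is in general position if no three of its points
are collinear. -/
def InGeneralPosition (P : Finset Plane) : Prop :=
  ∀ a ∈ P, ∀ b ∈ P, ∀ c ∈ P, a ≠ b → a ≠ c → b ≠ c →
    ¬ Collinear ℝ ({a, b, c} : Set Plane)

/-- The edges of the complete geometric graph with vertex set `P`: the pairs of distinct points
of `P`. The edge `{a, b}` is drawn as the straight line segment from `a` to `b`, which is
the convex hull of `{a, b}`. -/
def geometricEdges (P : Finset Plane) : Finset (Finset Plane) :=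
  P.powersetCard 2

/-- Two edges cross if they have no common endpoint and their segments meet. When the
endpoints are in general position, the segments of two distinct edges meet in a relative interior
point of both exactly in this case. -/
def EdgesCross (e f : Finset Plane) : Prop :=
  Disjoint e f ∧ (convexHull ℝ (e : Set Plane) ∩ convexHull ℝ (f : Set Plane)).Nonempty

open Classical in
/-- The number of crossings of the complete geometric graph with vertex set `P`: the number of
unordered pairs of edges that cross. -/
noncomputable def numCrossings (P : Finset Plane) : ℕ :=
  (((geometricEdges P).powersetCard 2).filter
    (fun X => ∃ e f : Finset Plane, X = {e, f} ∧ EdgesCross e f)).card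

/-- The rectilinear crossing number of `K_n`: the minimum number of crossings over all
`n`-point sets in general position in the plane. -/
noncomputable def rectilinearCrossingNumber (n : ℕ) : ℕ :=
  sInf {c : ℕ | ∃ P : Finset Plane, P.card = n ∧ InGeneralPosition P ∧ numCrossings P = c}

/-- There are `n`-point sets in general position for every `n` (on a parabola), so the
minimum above is over a nonempty set. -/
theorem exists_inGeneralPosition (n : ℕ) :
    ∃ P : Finset Plane, P.card = n ∧ InGeneralPosition P := by
  have hinj : Function.Injective (fun i : ℕ => (!₂[(i : ℝ), (i : ℝ) ^ 2] : Plane)) := by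
    intro i j h
    have h0 := congrArg (fun p : Plane => p 0) h
    simpa using h0
  refine ⟨(Finset.range n).map ⟨_, hinj⟩, by simp, ?_⟩
  intro a ha b hb c hc hab hac hbc hcol
  simp only [Finset.mem_map, Function.Embedding.coeFn_mk] at ha hb hc
  obtain ⟨i, -, rfl⟩ := ha
  obtain ⟨j, -, rfl⟩ := hb
  obtain ⟨k, -, rfl⟩ := hc
  have hij : (i : ℝ) ≠ j := fun h => hab (by simp [h])
  have hik : (i : ℝ) ≠ k := fun h => hac (by simp [h])
  have hjk : (j : ℝ) ≠ k := fun h => hbc (by simp [h])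
  rw [collinear_iff_of_mem (p₀ := !₂[(i : ℝ), (i : ℝ) ^ 2]) (by simp)] at hcol
  obtain ⟨v, hv⟩ := hcol
  obtain ⟨r, hr⟩ := hv (!₂[(j : ℝ), (j : ℝ) ^ 2]) (by simp)
  obtain ⟨s, hs⟩ := hv (!₂[(k : ℝ), (k : ℝ) ^ 2]) (by simp)
  have r0 := congrArg (fun p : Plane => p 0) hr
  have r1 := congrArg (fun p : Plane => p 1) hr
  have s0 := congrArg (fun p : Plane => p 0) hs
  have s1 := congrArg (fun p : Plane => p 1) hs
  simp at r0 r1 s0 s1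
  have key : ((j : ℝ) - i) * (k - i) * (k - j) = 0 := by
    have e1 : (j : ℝ) - i = r * v 0 := by linarith
    have e2 : (j : ℝ) ^ 2 - i ^ 2 = r * v 1 := by linarith
    have e3 : (k : ℝ) - i = s * v 0 := by linarith
    have e4 : (k : ℝ) ^ 2 - i ^ 2 = s * v 1 := by linarith
    have : ((j : ℝ) - i) * (k ^ 2 - i ^ 2) - (k - i) * (j ^ 2 - i ^ 2) = 0 := by
      rw [e1, e2, e3, e4]; ring
    linear_combination this
  rcases mul_eq_zero.1 key with h | h
  · rcases mul_eq_zero.1 h with h | h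
    · exact hij (by linarith)
    · exact hik (by linarith)
  · exact hjk (by linarith)

/-- Twice the signed area of the triangle `p q r`: positive when `r` lies to the left of the line
from `p` to `q`. -/
def orient (p q r : Plane) : ℝ := (q 0 - p 0) * (r 1 - p 1) - (q 1 - p 1) * (r 0 - p 0)

theorem orient_swap (p q r : Plane) : orient q p r = -orient p q r := by
  unfold orient; ring

theorem orient_swap_right (p q r : Plane) : orient p r q = -orient p q r := by
  unfold orient; ring

theorem orient_rotate (p q r : Plane) : orient q r p = orient p q r := by
  unfold orient; ring

theorem orient_self_left (p q : Plane) : orient p q p = 0 := by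
  unfold orient; ring

theorem orient_self_right (p q : Plane) : orient p q q = 0 := by
  unfold orient; ring

theorem orient_self (p q : Plane) : orient p p q = 0 := by
  unfold orient; ring

theorem orient_eq_zero_of_collinear {p q r : Plane} (h : Collinear ℝ ({p, q, r} : Set Plane)) :
    orient p q r = 0 := by
  rw [collinear_iff_of_mem (p₀ := p) (by simp)] at h
  obtain ⟨v, hv⟩ := h
  obtain ⟨s, hs⟩ := hv q (by simp)
  obtain ⟨t, ht⟩ := hv r (by simp)
  subst hs ht
  simp [orient]
  ring

/-- An indexed family of distinct points, no three of them on a line. -/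
structure GenPos {ι : Type*} (x : ι → Plane) : Prop where
  inj : Function.Injective x
  ne_zero : ∀ a b c, a ≠ b → a ≠ c → b ≠ c → orient (x a) (x b) (x c) ≠ 0

theorem GenPos.inGeneralPosition {ι : Type*} [Fintype ι] [DecidableEq Plane] {x : ι → Plane}
    (hx : GenPos x) : InGeneralPosition (Finset.univ.image x) := by
  intro a ha b hb c hc hab hac hbc hcol
  simp only [Finset.mem_image, Finset.mem_univ, true_and] at ha hb hc
  obtain ⟨i, rfl⟩ := ha
  obtain ⟨j, rfl⟩ := hb
  obtain ⟨k, rfl⟩ := hc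
  exact hx.ne_zero i j k (fun h => hab (h ▸ rfl)) (fun h => hac (h ▸ rfl)) (fun h => hbc (h ▸ rfl))
    (orient_eq_zero_of_collinear hcol)

/-- The line through `p` and `q` separates `r` from `s`. -/
def Separates (p q r s : Plane) : Prop := orient p q r * orient p q s < 0

theorem Separates.of_meet {p q r s : Plane} (hr : orient p q r ≠ 0) (hs : orient p q s ≠ 0)
    (h : (segment ℝ p q ∩ segment ℝ r s).Nonempty) : Separates p q r s := by
  obtain ⟨z, ⟨a, b, -, -, hab, hz⟩, ⟨c, d, hc, hd, hcd, hz'⟩⟩ := h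
  have h0 : orient p q z = 0 := by
    have : a = 1 - b := by linarith
    subst this
    rw [← hz]; simp [orient]; ring
  have h1 : c * orient p q r + d * orient p q s = 0 := by
    rw [← h0, ← hz']
    have : c = 1 - d := by linarith
    subst this
    simp [orient]; ring
  unfold Separates
  rcases lt_or_gt_of_ne hr with h2 | h2 <;> rcases lt_or_gt_of_ne hs with h3 | h3
  · nlinarith [mul_nonneg hc (neg_nonneg.2 h2.le), mul_nonneg hd (neg_nonneg.2 h3.le), mul_pos (neg_pos.2 h2) (neg_pos.2 h3)]
  · exact mul_neg_of_neg_of_pos h2 h3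
  · exact mul_neg_of_pos_of_neg h2 h3
  · nlinarith [mul_nonneg hc h2.le, mul_nonneg hd h3.le, mul_pos h2 h3]

open Classical in
/-- The number of points of the family to the left of the line from `x a` to `x b`. -/
noncomputable def leftCount {ι : Type*} [Fintype ι] (x : ι → Plane) (a b : ι) : ℕ :=
  ∑ c, if 0 < orient (x a) (x b) (x c) then 1 else 0

/-- The sum over all ordered pairs of the product of the numbers of points on the two sides of
the line through the pair. -/
noncomputable def sideSum {ι : Type*} [Fintype ι] (x : ι → Plane) : ℕ :=
  ∑ a, ∑ b, leftCount x a b * leftCount x b a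

/-- The segments `p q` and `r s` cross, in terms of orientations. -/
def SegCross (p q r s : Plane) : Prop := Separates p q r s ∧ Separates r s p q

theorem Separates.distinct {ι : Type*} {x : ι → Plane} {a b c d : ι}
    (h : Separates (x a) (x b) (x c) (x d)) :
    a ≠ b ∧ a ≠ c ∧ a ≠ d ∧ b ≠ c ∧ b ≠ d ∧ c ≠ d := by
  unfold Separates at h
  refine ⟨?_, ?_, ?_, ?_, ?_, ?_⟩ <;> rintro rfl
  · simp [orient_self] at h
  · simp [orient_self_left] at h
  · simp [orient_self_left] at h
  · simp [orient_self_right] at h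
  · simp [orient_self_right] at h
  · exact absurd h (not_lt.2 (mul_self_nonneg _))

open Classical in
/-- A four-point set has either two separating edges and one crossing or three separating edges
and no crossing. -/
theorem separates_add_segCross {p q r s : Plane} (h1 : orient p q r ≠ 0) (h2 : orient p q s ≠ 0)
    (h3 : orient p r s ≠ 0) (h4 : orient q r s ≠ 0) :
    (if Separates p q r s then 1 else 0) + (if Separates p r q s then 1 else 0) +
      (if Separates p s q r then 1 else 0) + (if Separates q r p s then 1 else 0) +
      (if Separates q s p r then 1 else 0) + (if Separates r s p q then 1 else 0) +
      (if SegCross p q r s then 1 else 0) + (if SegCross p r q s then 1 else 0) +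
      (if SegCross p s q r then 1 else 0) = 3 := by
  have key : orient p q r - orient p q s + orient p r s - orient q r s = 0 := by
    unfold orient; ring
  have e1 : orient p r q = -orient p q r := orient_swap_right _ _ _
  have e2 : orient p s q = -orient p q s := orient_swap_right _ _ _
  have e3 : orient p s r = -orient p r s := orient_swap_right _ _ _
  have e4 : orient q r p = orient p q r := orient_rotate _ _ _
  have e5 : orient q s p = orient p q s := orient_rotate _ _ _
  have e6 : orient q s r = -orient q r s := orient_swap_right _ _ _
  have e7 : orient r s p = orient p r s := orient_rotate _ _ _
  have e8 : orient r s q = orient q r s := orient_rotate _ _ _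
  simp only [SegCross, Separates, e1, e2, e3, e4, e5, e6, e7, e8]
  rcases lt_or_gt_of_ne h1 with hA | hA <;> rcases lt_or_gt_of_ne h2 with hB | hB <;>
  rcases lt_or_gt_of_ne h3 with hC | hC <;> rcases lt_or_gt_of_ne h4 with hD | hD <;>
  first
  | (exfalso; linarith)
  | simp [mul_neg_iff, mul_pos_iff, hA, hB, hC, hD, hA.not_gt, hB.not_gt, hC.not_gt, hD.not_gt]

section Crossings

variable {ι : Type*} [Fintype ι]

open Classical in
theorem sum_separates (x : ι → Plane) :
    ∑ a, ∑ b, ∑ c, ∑ d, (if Separates (x a) (x b) (x c) (x d) then 1 else 0) = 2 * sideSum x := by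
  have h (a b : ι) : ∑ c, ∑ d, (if Separates (x a) (x b) (x c) (x d) then 1 else 0) =
      2 * (leftCount x a b * leftCount x b a) := by
    have h1 (c d : ι) : (if Separates (x a) (x b) (x c) (x d) then 1 else 0) =
        (if 0 < orient (x a) (x b) (x c) then 1 else 0) *
          (if 0 < orient (x b) (x a) (x d) then 1 else 0) +
        (if 0 < orient (x b) (x a) (x c) then 1 else 0) *
          (if 0 < orient (x a) (x b) (x d) then 1 else 0) := by
      simp only [Separates, orient_swap (x a) (x b), mul_neg_iff, neg_pos]
      split_ifs <;> first | rfl | (exfalso; grind)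
    simp only [h1, Finset.sum_add_distrib, ← Finset.mul_sum, ← Finset.sum_mul]
    unfold leftCount
    ring
  simp only [h, sideSum, Finset.mul_sum]

open Classical in
theorem sum_distinct :
    ∑ a : ι, ∑ b : ι, ∑ c : ι, ∑ d : ι,
      (if a ≠ b ∧ a ≠ c ∧ a ≠ d ∧ b ≠ c ∧ b ≠ d ∧ c ≠ d then 1 else 0) =
    24 * (Fintype.card ι).choose 4 := by
  have h : ∑ a : ι, ∑ b : ι, ∑ c : ι, ∑ d : ι,
      (if a ≠ b ∧ a ≠ c ∧ a ≠ d ∧ b ≠ c ∧ b ≠ d ∧ c ≠ d then 1 else 0) =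
      Fintype.card (Fin 4 ↪ ι) := by
    rw [← Fintype.sum_prod_type', ← Fintype.sum_prod_type', ← Fintype.sum_prod_type',
      ← Finset.card_filter]
    symm
    refine Finset.card_bij (fun f _ => (((f 0, f 1), f 2), f 3)) ?_ ?_ ?_
    · intro f _
      simp [f.injective.eq_iff]
    · intro f _ g _ hfg
      simp only [Prod.mk.injEq] at hfg
      ext i
      fin_cases i <;> simp [hfg]
    · rintro ⟨⟨⟨a, b⟩, c⟩, d⟩ hq
      simp only [Finset.mem_filter, Finset.mem_univ, true_and] at hq
      refine ⟨⟨![a, b, c, d], ?_⟩, Finset.mem_univ _, rfl⟩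
      intro i j hij
      fin_cases i <;> fin_cases j <;> simp_all
  rw [h, Fintype.card_embedding_eq, Fintype.card_fin, Nat.descFactorial_eq_factorial_mul_choose]
  rfl

open Classical in
theorem sideSum_add_segCross_le {x : ι → Plane} (hx : GenPos x) :
    12 * sideSum x + 3 * ∑ a, ∑ b, ∑ c, ∑ d,
      (if SegCross (x a) (x b) (x c) (x d) then 1 else 0) ≤ 72 * (Fintype.card ι).choose 4 := by
  have key : ∑ a, ∑ b, ∑ c, ∑ d,
      ((if Separates (x a) (x b) (x c) (x d) then 1 else 0) +
      (if Separates (x a) (x c) (x b) (x d) then 1 else 0) +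
      (if Separates (x a) (x d) (x b) (x c) then 1 else 0) +
      (if Separates (x b) (x c) (x a) (x d) then 1 else 0) +
      (if Separates (x b) (x d) (x a) (x c) then 1 else 0) +
      (if Separates (x c) (x d) (x a) (x b) then 1 else 0) +
      (if SegCross (x a) (x b) (x c) (x d) then 1 else 0) +
      (if SegCross (x a) (x c) (x b) (x d) then 1 else 0) +
      (if SegCross (x a) (x d) (x b) (x c) then 1 else 0)) ≤
      ∑ a : ι, ∑ b : ι, ∑ c : ι, ∑ d : ι,
      3 * (if a ≠ b ∧ a ≠ c ∧ a ≠ d ∧ b ≠ c ∧ b ≠ d ∧ c ≠ d then 1 else 0) := by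
    refine Finset.sum_le_sum fun a _ => Finset.sum_le_sum fun b _ => Finset.sum_le_sum fun c _ =>
      Finset.sum_le_sum fun d _ => ?_
    by_cases h : a ≠ b ∧ a ≠ c ∧ a ≠ d ∧ b ≠ c ∧ b ≠ d ∧ c ≠ d
    · obtain ⟨h1, h2, h3, h4, h5, h6⟩ := id h
      rw [if_pos h]
      exact (separates_add_segCross (hx.ne_zero _ _ _ h1 h2 h4) (hx.ne_zero _ _ _ h1 h3 h5)
        (hx.ne_zero _ _ _ h2 h3 h6) (hx.ne_zero _ _ _ h4 h5 h6)).le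
    · have n1 : ¬ Separates (x a) (x b) (x c) (x d) := fun h' => by
        have := h'.distinct; grind
      have n2 : ¬ Separates (x a) (x c) (x b) (x d) := fun h' => by
        have := h'.distinct; grind
      have n3 : ¬ Separates (x a) (x d) (x b) (x c) := fun h' => by
        have := h'.distinct; grind
      have n4 : ¬ Separates (x b) (x c) (x a) (x d) := fun h' => by
        have := h'.distinct; grind
      have n5 : ¬ Separates (x b) (x d) (x a) (x c) := fun h' => by
        have := h'.distinct; grind
      have n6 : ¬ Separates (x c) (x d) (x a) (x b) := fun h' => by
        have := h'.distinct; grind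
      simp [SegCross, n1, n2, n3, n4, n5, n6]
  simp only [Finset.sum_add_distrib, ← Finset.mul_sum] at key
  rw [sum_distinct] at key
  have s0 := sum_separates x
  have s1 (S : Plane → Plane → Plane → Plane → Prop) :
      ∑ a, ∑ b, ∑ c, ∑ d, (if S (x a) (x c) (x b) (x d) then 1 else 0) =
      ∑ a, ∑ b, ∑ c, ∑ d, (if S (x a) (x b) (x c) (x d) then 1 else 0) :=
    Finset.sum_congr rfl fun a _ => Finset.sum_comm
  have s2 (S : Plane → Plane → Plane → Plane → Prop) :
      ∑ a, ∑ b, ∑ c, ∑ d, (if S (x a) (x d) (x b) (x c) then 1 else 0) =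
      ∑ a, ∑ b, ∑ c, ∑ d, (if S (x a) (x b) (x c) (x d) then 1 else 0) := by
    refine Finset.sum_congr rfl fun a _ => ?_
    rw [Finset.sum_congr rfl fun b _ => Finset.sum_comm, Finset.sum_comm]
  have s3 (S : Plane → Plane → Plane → Plane → Prop) :
      ∑ a, ∑ b, ∑ c, ∑ d, (if S (x b) (x c) (x a) (x d) then 1 else 0) =
      ∑ a, ∑ b, ∑ c, ∑ d, (if S (x a) (x b) (x c) (x d) then 1 else 0) := by
    rw [Finset.sum_comm, Finset.sum_congr rfl fun b _ => Finset.sum_comm]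
  have s4 (S : Plane → Plane → Plane → Plane → Prop) :
      ∑ a, ∑ b, ∑ c, ∑ d, (if S (x b) (x d) (x a) (x c) then 1 else 0) =
      ∑ a, ∑ b, ∑ c, ∑ d, (if S (x a) (x b) (x c) (x d) then 1 else 0) := by
    rw [Finset.sum_comm]
    refine Finset.sum_congr rfl fun b _ => ?_
    rw [Finset.sum_congr rfl fun b _ => Finset.sum_comm, Finset.sum_comm]
  have s5 (S : Plane → Plane → Plane → Plane → Prop) :
      ∑ a, ∑ b, ∑ c, ∑ d, (if S (x c) (x d) (x a) (x b) then 1 else 0) =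
      ∑ a, ∑ b, ∑ c, ∑ d, (if S (x a) (x b) (x c) (x d) then 1 else 0) := by
    rw [Finset.sum_congr rfl fun a _ => Finset.sum_comm, Finset.sum_comm]
    refine Finset.sum_congr rfl fun c _ => ?_
    rw [Finset.sum_congr rfl fun a _ => Finset.sum_comm, Finset.sum_comm]
  rw [s1 Separates, s2 Separates, s3 Separates, s4 Separates, s5 Separates, s1 SegCross,
    s2 SegCross, s0] at key
  omega

end Crossings

open Classical in
theorem segCross_of_edgesCross {ι : Type*} [Fintype ι] {x : ι → Plane} (hx : GenPos x)
    {a b c d : ι} (hab : a ≠ b) (hcd : c ≠ d)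
    (h : EdgesCross {x a, x b} {x c, x d}) : SegCross (x a) (x b) (x c) (x d) := by
  obtain ⟨hd, hm⟩ := h
  simp only [Finset.disjoint_insert_left, Finset.mem_insert, Finset.mem_singleton,
    Finset.disjoint_singleton_left, not_or, hx.inj.eq_iff] at hd
  obtain ⟨⟨hac, had⟩, hbc, hbd⟩ := hd
  simp only [Finset.coe_insert, Finset.coe_singleton, convexHull_pair] at hm
  have hm' := hm
  rw [Set.inter_comm] at hm'
  exact ⟨.of_meet (hx.ne_zero _ _ _ hab hac hbc) (hx.ne_zero _ _ _ hab had hbd) hm,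
    .of_meet (hx.ne_zero _ _ _ hcd (Ne.symm hac) (Ne.symm had))
      (hx.ne_zero _ _ _ hcd (Ne.symm hbc) (Ne.symm hbd)) hm'⟩

theorem EdgesCross.symm {e f : Finset Plane} (h : EdgesCross e f) : EdgesCross f e :=
  ⟨h.1.symm, by rw [Set.inter_comm]; exact h.2⟩

open Classical in
/-- The set of crossings counted by `numCrossings`. -/
noncomputable def crossings (P : Finset Plane) : Finset (Finset (Finset Plane)) :=
  ((geometricEdges P).powersetCard 2).filter
    (fun X => ∃ e f : Finset Plane, X = {e, f} ∧ EdgesCross e f)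

theorem card_crossings (P : Finset Plane) : (crossings P).card = numCrossings P := rfl

open Classical in
theorem mem_crossings {P : Finset Plane} {X : Finset (Finset Plane)} :
    X ∈ crossings P ↔ ∃ e f : Finset Plane, X = {e, f} ∧ EdgesCross e f ∧
      e ∈ geometricEdges P ∧ f ∈ geometricEdges P ∧ e ≠ f := by
  simp only [crossings, Finset.mem_filter, Finset.mem_powersetCard]
  constructor
  · rintro ⟨⟨h1, h2⟩, e, f, rfl, h⟩
    refine ⟨e, f, rfl, h, h1 (by simp), h1 (by simp), ?_⟩
    rintro rfl
    simp at h2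
  · rintro ⟨e, f, rfl, h, he, hf, hne⟩
    refine ⟨⟨?_, Finset.card_pair hne⟩, e, f, rfl, h⟩
    intro g hg
    simp only [Finset.mem_insert, Finset.mem_singleton] at hg
    rcases hg with rfl | rfl <;> assumption

open Classical in
theorem exists_of_mem_crossings {ι : Type*} [Fintype ι] {x : ι → Plane}
    {X : Finset (Finset Plane)} (hX : X ∈ crossings (Finset.univ.image x)) :
    ∃ a b c d : ι, X = {{x a, x b}, {x c, x d}} ∧ EdgesCross {x a, x b} {x c, x d} ∧
      a ≠ b ∧ c ≠ d := by
  obtain ⟨e, f, rfl, h, he, hf, -⟩ := mem_crossings.1 hX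
  simp only [geometricEdges, Finset.mem_powersetCard, Finset.card_eq_two] at he hf
  obtain ⟨he, p, q, hpq, rfl⟩ := he
  obtain ⟨hf, r, s, hrs, rfl⟩ := hf
  obtain ⟨a, -, rfl⟩ := Finset.mem_image.1 (he (Finset.mem_insert_self _ _))
  obtain ⟨b, -, rfl⟩ := Finset.mem_image.1 (he (Finset.mem_insert_of_mem (Finset.mem_singleton_self _)))
  obtain ⟨c, -, rfl⟩ := Finset.mem_image.1 (hf (Finset.mem_insert_self _ _))
  obtain ⟨d, -, rfl⟩ := Finset.mem_image.1 (hf (Finset.mem_insert_of_mem (Finset.mem_singleton_self _)))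
  exact ⟨a, b, c, d, rfl, h, fun h => hpq (h ▸ rfl), fun h => hrs (h ▸ rfl)⟩

open Classical in
theorem eight_mul_numCrossings_le {ι : Type*} [Fintype ι] {x : ι → Plane} (hx : GenPos x) :
    8 * numCrossings (Finset.univ.image x) ≤ ∑ a, ∑ b, ∑ c, ∑ d,
      (if SegCross (x a) (x b) (x c) (x d) then 1 else 0) := by
  rw [← Fintype.sum_prod_type', ← Fintype.sum_prod_type', ← Fintype.sum_prod_type',
    ← Finset.card_filter, ← card_crossings]
  let φ : ((ι × ι) × ι) × ι → Finset (Finset Plane) :=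
    fun q => {{x q.1.1.1, x q.1.1.2}, {x q.1.2, x q.2}}
  refine (Finset.mul_card_image_le_card_of_maps_to
    (s := Finset.univ.filter fun q => φ q ∈ crossings (Finset.univ.image x) ∧
      SegCross (x q.1.1.1) (x q.1.1.2) (x q.1.2) (x q.2))
    (f := φ) (t := crossings (Finset.univ.image x)) ?_ 8 ?_).trans (Finset.card_le_card ?_)
  · intro q hq
    exact (Finset.mem_filter.1 hq).2.1
  · intro X hX
    obtain ⟨a, b, c, d, rfl, h, hab, hcd⟩ := exists_of_mem_crossings hX
    have hs := segCross_of_edgesCross hx hab hcd h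
    obtain ⟨-, hac, had, hbc, hbd, -⟩ := hs.1.distinct
    have hcard : ({(((a, b), c), d), (((b, a), c), d), (((a, b), d), c), (((b, a), d), c),
        (((c, d), a), b), (((c, d), b), a), (((d, c), a), b), (((d, c), b), a)} :
        Finset (((ι × ι) × ι) × ι)).card = 8 := by
      rw [Finset.card_insert_of_notMem, Finset.card_insert_of_notMem,
        Finset.card_insert_of_notMem, Finset.card_insert_of_notMem,
        Finset.card_insert_of_notMem, Finset.card_insert_of_notMem,
        Finset.card_insert_of_notMem, Finset.card_singleton] <;>
      simp [hab, hcd, hac, had, hbc, hbd, hab.symm, hcd.symm, hac.symm, had.symm, hbc.symm,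
        hbd.symm]
    rw [← hcard]
    refine Finset.card_le_card ?_
    have main (p q r s : ι) (hpq : p ≠ q) (hrs : r ≠ s)
        (he : EdgesCross {x p, x q} {x r, x s})
        (hX' : ({{x p, x q}, {x r, x s}} : Finset (Finset Plane)) = {{x a, x b}, {x c, x d}}) :
        (((p, q), r), s) ∈ ((Finset.univ.filter fun q => φ q ∈ crossings (Finset.univ.image x) ∧
      SegCross (x q.1.1.1) (x q.1.1.2) (x q.1.2) (x q.2)).filter fun q =>
          φ q = {{x a, x b}, {x c, x d}}) := by
      simp only [Finset.mem_filter, Finset.mem_univ, true_and, φ, hX']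
      exact ⟨⟨hX, segCross_of_edgesCross hx hpq hrs he⟩, trivial⟩
    have pba : ({x b, x a} : Finset Plane) = {x a, x b} := Finset.pair_comm _ _
    have pdc : ({x d, x c} : Finset Plane) = {x c, x d} := Finset.pair_comm _ _
    have pX : ({{x c, x d}, {x a, x b}} : Finset (Finset Plane)) = {{x a, x b}, {x c, x d}} :=
      Finset.pair_comm _ _
    intro q hq
    simp only [Finset.mem_insert, Finset.mem_singleton] at hq
    rcases hq with rfl | rfl | rfl | rfl | rfl | rfl | rfl | rfl
    · exact main _ _ _ _ hab hcd h rfl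
    · exact main _ _ _ _ hab.symm hcd (by rw [pba]; exact h) (by rw [pba])
    · exact main _ _ _ _ hab hcd.symm (by rw [pdc]; exact h) (by rw [pdc])
    · exact main _ _ _ _ hab.symm hcd.symm (by rw [pba, pdc]; exact h) (by rw [pba, pdc])
    · exact main _ _ _ _ hcd hab h.symm pX
    · exact main _ _ _ _ hcd hab.symm (by rw [pba]; exact h.symm) (by rw [pba, pX])
    · exact main _ _ _ _ hcd.symm hab (by rw [pdc]; exact h.symm) (by rw [pdc, pX])
    · exact main _ _ _ _ hcd.symm hab.symm (by rw [pba, pdc]; exact h.symm)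
        (by rw [pba, pdc, pX])
  · intro q hq
    simp only [Finset.mem_filter, Finset.mem_univ, true_and] at hq ⊢
    exact hq.2

open Classical in
/-- The number of crossings in terms of the numbers of points on the two sides of the lines
through two points. -/
theorem sideSum_add_numCrossings_le {ι : Type*} [Fintype ι] {x : ι → Plane} (hx : GenPos x) :
    sideSum x + 2 * numCrossings (Finset.univ.image x) ≤ 6 * (Fintype.card ι).choose 4 := by
  have h1 := sideSum_add_segCross_le hx
  have h2 := eight_mul_numCrossings_le hx
  omega

theorem sideSum_add_rectilinearCrossingNumber_le {ι : Type*} [Fintype ι] {x : ι → Plane}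
    (hx : GenPos x) :
    sideSum x + 2 * rectilinearCrossingNumber (Fintype.card ι) ≤
      6 * (Fintype.card ι).choose 4 := by
  classical
  refine le_trans ?_ (sideSum_add_numCrossings_le hx)
  gcongr
  refine Nat.sInf_le ⟨_, ?_, hx.inGeneralPosition, rfl⟩
  rw [Finset.card_image_of_injective _ hx.inj, Finset.card_univ]

theorem exists_numCrossings_eq (n : ℕ) : ∃ P : Finset Plane,
    P.card = n ∧ InGeneralPosition P ∧ numCrossings P = rectilinearCrossingNumber n := by
  obtain ⟨P, h1, h2⟩ := exists_inGeneralPosition n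
  exact Nat.sInf_mem (s := {c : ℕ | ∃ P : Finset Plane,
    P.card = n ∧ InGeneralPosition P ∧ numCrossings P = c}) ⟨_, P, h1, h2, rfl⟩

open Classical in
/-- Each crossing survives the deletion of all but four of the points. -/
theorem sum_numCrossings_erase_le (P : Finset Plane) :
    ∑ p ∈ P, numCrossings (P.erase p) ≤ (P.card - 4) * numCrossings P := by
  have h1 (p : Plane) : crossings (P.erase p) ⊆ (crossings P).filter (fun X => p ∉ X.sup id) := by
    intro X hX
    obtain ⟨e, f, rfl, h, he, hf, hne⟩ := mem_crossings.1 hX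
    simp only [geometricEdges, Finset.mem_powersetCard] at he hf
    refine Finset.mem_filter.2 ⟨mem_crossings.2 ⟨e, f, rfl, h, ?_, ?_, hne⟩, ?_⟩
    · exact Finset.mem_powersetCard.2 ⟨he.1.trans (Finset.erase_subset _ _), he.2⟩
    · exact Finset.mem_powersetCard.2 ⟨hf.1.trans (Finset.erase_subset _ _), hf.2⟩
    · simp only [Finset.sup_insert, Finset.sup_singleton, id, Finset.sup_eq_union,
        Finset.mem_union, not_or]
      exact ⟨fun h => Finset.notMem_erase p P (he.1 h), fun h => Finset.notMem_erase p P (hf.1 h)⟩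
  have h2 (X) (hX : X ∈ crossings P) : (P.filter fun p => p ∉ X.sup id).card = P.card - 4 := by
    obtain ⟨e, f, rfl, h, he, hf, hne⟩ := mem_crossings.1 hX
    simp only [geometricEdges, Finset.mem_powersetCard] at he hf
    have : (P.filter fun p => p ∉ ({e, f} : Finset (Finset Plane)).sup id) = P \ (e ∪ f) := by
      ext p
      simp [Finset.mem_sdiff]
    rw [this, Finset.card_sdiff_of_subset (Finset.union_subset he.1 hf.1),
      Finset.card_union_of_disjoint h.1, he.2, hf.2]
  calc ∑ p ∈ P, numCrossings (P.erase p)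
      ≤ ∑ p ∈ P, ((crossings P).filter (fun X => p ∉ X.sup id)).card :=
        Finset.sum_le_sum fun p _ => Finset.card_le_card (h1 p)
    _ = ∑ X ∈ crossings P, (P.filter fun p => p ∉ X.sup id).card := by
        simp only [Finset.card_filter]
        exact Finset.sum_comm
    _ = (P.card - 4) * numCrossings P := by
        rw [Finset.sum_congr rfl h2, Finset.sum_const, card_crossings, smul_eq_mul, mul_comm]

theorem succ_mul_rectilinearCrossingNumber_le (n : ℕ) :
    (n + 1) * rectilinearCrossingNumber n ≤ (n - 3) * rectilinearCrossingNumber (n + 1) := by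
  classical
  obtain ⟨P, hc, hP, hn⟩ := exists_numCrossings_eq (n + 1)
  have h := sum_numCrossings_erase_le P
  rw [hc, hn] at h
  refine le_trans ?_ h
  rw [← hc, ← smul_eq_mul, ← Finset.sum_const]
  refine Finset.sum_le_sum fun p hp => Nat.sInf_le ⟨P.erase p, ?_, ?_, rfl⟩
  · rw [Finset.card_erase_of_mem hp, hc]; rfl
  · intro a ha b hb c hc
    exact hP a (Finset.mem_of_mem_erase ha) b (Finset.mem_of_mem_erase hb) c
      (Finset.mem_of_mem_erase hc)

theorem monotone_crossing_density :
    Monotone fun n : ℕ => (rectilinearCrossingNumber n : ℝ) / (n.choose 4 : ℝ) := by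
  refine monotone_nat_of_le_succ fun n => ?_
  rcases lt_or_ge n 4 with hn | hn
  · rw [Nat.choose_eq_zero_of_lt hn]
    simp only [Nat.cast_zero, div_zero]
    positivity
  · obtain ⟨k, rfl⟩ := Nat.exists_eq_add_of_le' hn
    have h1 := succ_mul_rectilinearCrossingNumber_le (k + 4)
    have h2 : (k + 4 + 1).choose 4 * (k + 1) = (k + 4 + 1) * (k + 4).choose 4 := by
      have := Nat.choose_mul_succ_eq (k + 4) 4
      rw [show k + 4 + 1 - 4 = k + 1 by omega] at this
      linarith
    have p1 : 0 < (k + 4).choose 4 := Nat.choose_pos (by omega)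
    have p2 : 0 < (k + 4 + 1).choose 4 := Nat.choose_pos (by omega)
    rw [show k + 4 - 3 = k + 1 by omega] at h1
    rw [div_le_div_iff₀ (by exact_mod_cast p1) (by exact_mod_cast p2)]
    norm_cast
    have : (k + 1) * (rectilinearCrossingNumber (k + 4) * (k + 4 + 1).choose 4) ≤
        (k + 1) * (rectilinearCrossingNumber (k + 4 + 1) * (k + 4).choose 4) := by
      calc _ = ((k + 4 + 1) * rectilinearCrossingNumber (k + 4)) * (k + 4).choose 4 := by
            rw [mul_left_comm, mul_comm (k + 1), h2]; ring
        _ ≤ ((k + 1) * rectilinearCrossingNumber (k + 4 + 1)) * (k + 4).choose 4 := by gcongr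
        _ = _ := by ring
    exact Nat.le_of_mul_le_mul_left this (by omega)

theorem parabola_genPos (n : ℕ) :
    GenPos (fun i : Fin n => (!₂[(i : ℝ), (i : ℝ) ^ 2] : Plane)) := by
  constructor
  · intro i j h
    have h0 := congrArg (fun p : Plane => p 0) h
    simpa [Fin.ext_iff] using h0
  · intro i j k hij hik hjk
    have e : orient !₂[(i : ℝ), (i : ℝ) ^ 2] !₂[(j : ℝ), (j : ℝ) ^ 2] !₂[(k : ℝ), (k : ℝ) ^ 2] =
        (j - i) * (k - i) * (k - j) := by
      simp [orient]; ring
    rw [e]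
    have h (a b : Fin n) (hab : a ≠ b) : (b : ℝ) - a ≠ 0 := by
      rw [sub_ne_zero, Ne, Nat.cast_inj]
      exact fun h => hab (Fin.ext h.symm)
    exact mul_ne_zero (mul_ne_zero (h _ _ hij) (h _ _ hik)) (h _ _ hjk)

theorem crossing_density_le (n : ℕ) :
    (rectilinearCrossingNumber n : ℝ) / (n.choose 4 : ℝ) ≤ 3 := by
  have h := sideSum_add_rectilinearCrossingNumber_le (parabola_genPos n)
  rw [Fintype.card_fin] at h
  refine div_le_of_le_mul₀ (by positivity) (by norm_num) ?_
  norm_cast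
  omega

theorem exists_tendsto_crossing_density : ∃ q : ℝ,
    Tendsto (fun n : ℕ => (rectilinearCrossingNumber n : ℝ) / (n.choose 4 : ℝ)) atTop (𝓝 q) :=
  ⟨_, tendsto_atTop_ciSup monotone_crossing_density
    ⟨3, Set.forall_mem_range.2 crossing_density_le⟩⟩

/-- Each point `P p` is replaced by a small copy of `Q`, flattened along the line through `P p`
and `H p`. -/
noncomputable def blowup {ι κ : Type*} (P H : ι → Plane) (Q : κ → Plane) (ε : ℝ) (z : ι × κ) :
    Plane :=
  !₂[P z.1 0 + ε * (Q z.2 0 * (H z.1 0 - P z.1 0) - ε * (Q z.2 1 * (H z.1 1 - P z.1 1))),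
    P z.1 1 + ε * (Q z.2 0 * (H z.1 1 - P z.1 1) + ε * (Q z.2 1 * (H z.1 0 - P z.1 0)))]

theorem eventually_pos_iff {f : ℝ → ℝ} (hf : Continuous f) (h0 : f 0 ≠ 0) :
    ∀ᶠ ε in 𝓝[>] (0 : ℝ), f ε ≠ 0 ∧ (0 < f ε ↔ 0 < f 0) := by
  refine Filter.Eventually.filter_mono nhdsWithin_le_nhds ?_
  rcases lt_or_gt_of_ne h0 with h | h
  · filter_upwards [hf.continuousAt.eventually_lt continuousAt_const h] with ε hε
    exact ⟨hε.ne, by simp [hε.not_gt, h.not_gt]⟩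
  · filter_upwards [continuousAt_const.eventually_lt hf.continuousAt h] with ε hε
    exact ⟨hε.ne', by simp [hε, h]⟩

section Blowup

variable {ι κ : Type*} {P H : ι → Plane} {Q : κ → Plane}

theorem eventually_orient_blowup_of_ne (hP : GenPos P) {p q r : ι} (hpq : p ≠ q) (hpr : p ≠ r)
    (hqr : q ≠ r) (a b c : κ) :
    ∀ᶠ ε in 𝓝[>] (0 : ℝ),
      orient (blowup P H Q ε (p, a)) (blowup P H Q ε (q, b)) (blowup P H Q ε (r, c)) ≠ 0 ∧
      (0 < orient (blowup P H Q ε (p, a)) (blowup P H Q ε (q, b)) (blowup P H Q ε (r, c)) ↔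
        0 < orient (P p) (P q) (P r)) := by
  have h0 : orient (blowup P H Q 0 (p, a)) (blowup P H Q 0 (q, b)) (blowup P H Q 0 (r, c)) =
      orient (P p) (P q) (P r) := by simp [orient, blowup]
  have := eventually_pos_iff (f := fun ε => orient (blowup P H Q ε (p, a)) (blowup P H Q ε (q, b))
    (blowup P H Q ε (r, c))) (by simp only [orient, blowup]; simp; fun_prop)
    (by rw [h0]; exact hP.ne_zero _ _ _ hpq hpr hqr)
  simpa only [h0] using this

theorem eventually_orient_blowup_pair (hH : ∀ p q, p ≠ q → orient (P p) (H p) (P q) ≠ 0)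
    (hQ : Function.Injective fun a => Q a 0) {p q : ι} (hpq : p ≠ q) {a b : κ} (hab : a ≠ b)
    (c : κ) :
    ∀ᶠ ε in 𝓝[>] (0 : ℝ),
      orient (blowup P H Q ε (p, a)) (blowup P H Q ε (p, b)) (blowup P H Q ε (q, c)) ≠ 0 ∧
      (0 < orient (blowup P H Q ε (p, a)) (blowup P H Q ε (p, b)) (blowup P H Q ε (q, c)) ↔
        0 < (Q b 0 - Q a 0) * orient (P p) (H p) (P q)) := by
  let f : ℝ → ℝ := fun ε =>
    ((Q b 0 - Q a 0) * (H p 0 - P p 0) - ε * ((Q b 1 - Q a 1) * (H p 1 - P p 1))) *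
      (blowup P H Q ε (q, c) 1 - blowup P H Q ε (p, a) 1) -
    ((Q b 0 - Q a 0) * (H p 1 - P p 1) + ε * ((Q b 1 - Q a 1) * (H p 0 - P p 0))) *
      (blowup P H Q ε (q, c) 0 - blowup P H Q ε (p, a) 0)
  have hf (ε : ℝ) : orient (blowup P H Q ε (p, a)) (blowup P H Q ε (p, b))
      (blowup P H Q ε (q, c)) = ε * f ε := by
    simp [f, orient, blowup]; ring
  have h0 : f 0 = (Q b 0 - Q a 0) * orient (P p) (H p) (P q) := by
    simp [f, orient, blowup]; ring
  have := eventually_pos_iff (f := f) (by simp only [f, blowup]; simp; fun_prop)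
    (by
      rw [h0]
      exact mul_ne_zero (sub_ne_zero.2 fun h => hab (hQ h.symm)) (hH _ _ hpq))
  filter_upwards [this, self_mem_nhdsWithin] with ε hε hpos
  have hpos : 0 < ε := hpos
  rw [hf, ← h0]
  exact ⟨mul_ne_zero hpos.ne' hε.1, by rw [mul_pos_iff_of_pos_left hpos, hε.2]⟩

theorem orient_blowup_same (ε : ℝ) (p : ι) (a b c : κ) :
    orient (blowup P H Q ε (p, a)) (blowup P H Q ε (p, b)) (blowup P H Q ε (p, c)) =
      ε ^ 3 * ((H p 0 - P p 0) ^ 2 + (H p 1 - P p 1) ^ 2) * orient (Q a) (Q b) (Q c) := by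
  simp [orient, blowup]; ring

theorem eventually_blowup_x_ne (hP : Function.Injective fun p => P p 0)
    (hH : ∀ p, H p 0 ≠ P p 0) (hQ : Function.Injective fun a => Q a 0) {s t : ι × κ}
    (hst : s ≠ t) :
    ∀ᶠ ε in 𝓝[>] (0 : ℝ), blowup P H Q ε s 0 ≠ blowup P H Q ε t 0 := by
  obtain ⟨p, a⟩ := s
  obtain ⟨q, b⟩ := t
  by_cases hpq : p = q
  · subst hpq
    have hab : a ≠ b := fun h => hst (by rw [h])
    have := eventually_pos_iff (f := fun ε => (Q a 0 - Q b 0) * (H p 0 - P p 0) -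
      ε * ((Q a 1 - Q b 1) * (H p 1 - P p 1))) (by fun_prop)
      (by
        simp only [zero_mul, sub_zero]
        exact mul_ne_zero (sub_ne_zero.2 fun h => hab (hQ h)) (sub_ne_zero.2 (hH p)))
    filter_upwards [this, self_mem_nhdsWithin] with ε hε hpos h
    have hpos : 0 < ε := hpos
    refine mul_ne_zero hpos.ne' hε.1 ?_
    simp only [blowup, PiLp.toLp_apply, Matrix.cons_val_zero] at h
    linear_combination h
  · have := eventually_pos_iff (f := fun ε => blowup P H Q ε (p, a) 0 - blowup P H Q ε (q, b) 0)
      (by simp only [blowup]; simp; fun_prop)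
      (by
        simp only [blowup]
        simpa [sub_eq_zero] using fun h => hpq (hP h))
    filter_upwards [this] with ε hε
    exact sub_ne_zero.1 hε.1

/-- The order type of a blow-up with small parameter. -/
structure IsFlatBlowup (P H : ι → Plane) (Q : κ → Plane) (z : ι × κ → Plane) : Prop where
  genPos : GenPos z
  x_inj : Function.Injective fun s => z s 0
  of_ne : ∀ p q r, p ≠ q → p ≠ r → q ≠ r → ∀ a b c,
    (0 < orient (z (p, a)) (z (q, b)) (z (r, c)) ↔ 0 < orient (P p) (P q) (P r))
  pair : ∀ p q, p ≠ q → ∀ a b c, a ≠ b →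
    (0 < orient (z (p, a)) (z (p, b)) (z (q, c)) ↔ 0 < (Q b 0 - Q a 0) * orient (P p) (H p) (P q))
  same : ∀ p a b c,
    (0 < orient (z (p, a)) (z (p, b)) (z (p, c)) ↔ 0 < orient (Q a) (Q b) (Q c))

theorem exists_isFlatBlowup [Finite ι] [Finite κ] (hP : GenPos P)
    (hPx : Function.Injective fun p => P p 0) (hHx : ∀ p, H p 0 ≠ P p 0)
    (hH : ∀ p q, p ≠ q → orient (P p) (H p) (P q) ≠ 0) (hQ : GenPos Q)
    (hQx : Function.Injective fun a => Q a 0) :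
    ∃ z : ι × κ → Plane, IsFlatBlowup P H Q z := by
  have e1 : ∀ᶠ ε in 𝓝[>] (0 : ℝ), ∀ s t : ι × κ, s ≠ t →
      blowup P H Q ε s 0 ≠ blowup P H Q ε t 0 := by
    simp only [eventually_all]
    exact fun s t hst => eventually_blowup_x_ne hPx hHx hQx hst
  have e2 : ∀ᶠ ε in 𝓝[>] (0 : ℝ), ∀ p q r, p ≠ q → p ≠ r → q ≠ r → ∀ a b c,
      orient (blowup P H Q ε (p, a)) (blowup P H Q ε (q, b)) (blowup P H Q ε (r, c)) ≠ 0 ∧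
      (0 < orient (blowup P H Q ε (p, a)) (blowup P H Q ε (q, b)) (blowup P H Q ε (r, c)) ↔
        0 < orient (P p) (P q) (P r)) := by
    simp only [eventually_all]
    exact fun p q r hpq hpr hqr a b c => eventually_orient_blowup_of_ne hP hpq hpr hqr a b c
  have e3 : ∀ᶠ ε in 𝓝[>] (0 : ℝ), ∀ p q, p ≠ q → ∀ a b c, a ≠ b →
      orient (blowup P H Q ε (p, a)) (blowup P H Q ε (p, b)) (blowup P H Q ε (q, c)) ≠ 0 ∧
      (0 < orient (blowup P H Q ε (p, a)) (blowup P H Q ε (p, b)) (blowup P H Q ε (q, c)) ↔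
        0 < (Q b 0 - Q a 0) * orient (P p) (H p) (P q)) := by
    simp only [eventually_all]
    exact fun p q hpq a b c hab => eventually_orient_blowup_pair hH hQx hpq hab c
  obtain ⟨ε, h1, h2, h3, hpos⟩ := (e1.and (e2.and (e3.and self_mem_nhdsWithin))).exists
  have hpos : 0 < ε := hpos
  have hd (p : ι) : 0 < ε ^ 3 * ((H p 0 - P p 0) ^ 2 + (H p 1 - P p 1) ^ 2) := by
    have : 0 < (H p 0 - P p 0) ^ 2 := by
      have := sub_ne_zero.2 (hHx p)
      positivity
    positivity
  refine ⟨blowup P H Q ε, ⟨⟨?_, ?_⟩, ?_, fun p q r hpq hpr hqr a b c => (h2 p q r hpq hpr hqr a b c).2,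
    fun p q hpq a b c hab => (h3 p q hpq a b c hab).2, fun p a b c => ?_⟩⟩
  · intro s t hst
    by_contra hne
    exact h1 s t hne (congrArg (fun p : Plane => p 0) hst)
  · rintro ⟨p, a⟩ ⟨q, b⟩ ⟨r, c⟩ hab hac hbc
    by_cases hpq : p = q
    · subst hpq
      have hab : a ≠ b := fun h => hab (by rw [h])
      by_cases hpr : p = r
      · subst hpr
        have hac : a ≠ c := fun h => hac (by rw [h])
        have hbc : b ≠ c := fun h => hbc (by rw [h])
        rw [orient_blowup_same]
        exact mul_ne_zero (hd p).ne' (hQ.ne_zero _ _ _ hab hac hbc)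
      · exact (h3 p r hpr a b c hab).1
    · by_cases hpr : p = r
      · subst hpr
        have hac : a ≠ c := fun h => hac (by rw [h])
        rw [← orient_rotate, ← orient_rotate]
        exact (h3 p q hpq c a b hac.symm).1
      · by_cases hqr : q = r
        · subst hqr
          have hbc : b ≠ c := fun h => hbc (by rw [h])
          rw [← orient_rotate]
          exact (h3 q p (Ne.symm hpq) b c a hbc).1
        · exact (h2 p q r hpq hpr hqr a b c).1
  · intro s t hst
    by_contra hne
    exact h1 s t hne hst
  · rw [orient_blowup_same, mul_pos_iff_of_pos_left (hd p)]

end Blowup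

section Counting

theorem leftCount_self {ι : Type*} [Fintype ι] (x : ι → Plane) (a : ι) : leftCount x a a = 0 := by
  simp [leftCount, orient_self]

theorem GenPos.leftCount_add {ι : Type*} [Fintype ι] {x : ι → Plane} (hx : GenPos x) {a b : ι}
    (hab : a ≠ b) : leftCount x a b + leftCount x b a + 2 = Fintype.card ι := by
  classical
  have h (c : ι) : (if 0 < orient (x a) (x b) (x c) then 1 else 0) +
      (if 0 < orient (x b) (x a) (x c) then 1 else 0) + ((if c = a then 1 else 0) +
        (if c = b then 1 else 0)) = 1 := by
    by_cases hca : c = a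
    · subst hca; simp [orient_self_left, orient_self_right, hab]
    by_cases hcb : c = b
    · subst hcb; simp [orient_self_left, orient_self_right, hca]
    rw [orient_swap (x a) (x b)]
    rcases lt_or_gt_of_ne (hx.ne_zero a b c hab (Ne.symm hca) (Ne.symm hcb)) with h | h <;>
    simp [h, h.not_gt, hca, hcb]
  have := Finset.sum_congr (rfl : (Finset.univ : Finset ι) = Finset.univ) fun c _ => h c
  simpa [Finset.sum_add_distrib, leftCount] using this

theorem sum_fin_val (m : ℕ) : ∑ i : Fin m, (i : ℝ) = m * (m - 1) / 2 := by
  rw [Fin.sum_univ_eq_sum_range (fun i => (i : ℝ))]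
  induction m with
  | zero => simp
  | succ k ih => rw [Finset.sum_range_succ, ih]; push_cast; ring

theorem sum_fin_val_sq (m : ℕ) : ∑ i : Fin m, (i : ℝ) ^ 2 = m * (m - 1) * (2 * m - 1) / 6 := by
  rw [Fin.sum_univ_eq_sum_range (fun i => (i : ℝ) ^ 2)]
  induction m with
  | zero => simp
  | succ k ih => rw [Finset.sum_range_succ, ih]; push_cast; ring

theorem sum_sum_sides (m : ℕ) (A B : ℝ) :
    ∑ i : Fin m, ∑ j : Fin m, (A + i + j) * (B + (m - 1 - i) + (m - 1 - j)) =
      m ^ 2 * (A * B) + m ^ 2 * (m - 1) * (A + B) + m ^ 2 * (m - 1) * (5 * m - 7) / 6 := by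
  have h (i j : Fin m) : (A + i + j) * (B + (m - 1 - i) + (m - 1 - j)) =
      (A * (B + 2 * (m - 1))) + (B + 2 * (m - 1) - A) * i + (B + 2 * (m - 1) - A) * j
        - (i : ℝ) ^ 2 - (j : ℝ) ^ 2 - 2 * (i * j) := by ring
  simp only [h, Finset.sum_add_distrib, Finset.sum_sub_distrib, ← Finset.mul_sum,
    ← Finset.sum_mul, sum_fin_val, sum_fin_val_sq, Finset.sum_const, Finset.card_univ,
    Fintype.card_fin, nsmul_eq_mul]
  ring

theorem card_fin_lt (m : ℕ) (a : Fin m) : ∑ c : Fin m, (if c < a then 1 else 0) = (a : ℕ) := by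
  rw [← Finset.card_filter, show Finset.univ.filter (fun c => c < a) = Finset.Iio a by ext; simp,
    Fin.card_Iio]

theorem card_fin_gt (m : ℕ) (a : Fin m) :
    ∑ c : Fin m, (if a < c then 1 else 0) = (a.rev : ℕ) := by
  rw [← Finset.card_filter, show Finset.univ.filter (fun c => a < c) = Finset.Ioi a by ext; simp,
    Fin.card_Ioi, Fin.val_rev]
  omega

variable {ι : Type*} {P H : ι → Plane} {m : ℕ} {Q : Fin m → Plane}
  {z : ι × Fin m → Plane}

theorem IsFlatBlowup.pair' (hz : IsFlatBlowup P H Q z) {p q : ι} (hpq : p ≠ q) (a b c : Fin m) :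
    0 < orient (z (p, a)) (z (p, b)) (z (q, c)) ↔
      0 < (Q b 0 - Q a 0) * orient (P p) (H p) (P q) := by
  by_cases hab : a = b
  · subst hab; simp [orient_self]
  · exact hz.pair p q hpq a b c hab

theorem StrictMono.sub_mul_pos_iff {f : Fin m → ℝ} (hf : StrictMono f) {t : ℝ} (ht : t ≠ 0)
    (a b : Fin m) : 0 < (f b - f a) * t ↔ if 0 < t then a < b else b < a := by
  rcases lt_or_gt_of_ne ht with h | h
  · rw [if_neg h.not_gt, ← neg_mul_neg, mul_pos_iff_of_pos_right (neg_pos.2 h), neg_sub, sub_pos,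
      hf.lt_iff_lt]
  · rw [if_pos h, mul_pos_iff_of_pos_right h, sub_pos, hf.lt_iff_lt]

variable [Fintype ι]

open Classical in
theorem IsFlatBlowup.leftCount_of_ne (hz : IsFlatBlowup P H Q z)
    (hH : ∀ p q, p ≠ q → orient (P p) (H p) (P q) ≠ 0)
    (hQ : StrictMono fun a => Q a 0) {p q : ι} (hpq : p ≠ q) (a b : Fin m) :
    leftCount z (p, a) (q, b) = m * leftCount P p q +
      ((if 0 < orient (P p) (H p) (P q) then a else a.rev : Fin m) : ℕ) +
      ((if 0 < orient (P q) (H q) (P p) then b.rev else b : Fin m) : ℕ) := by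
  have hr (r : ι) : ∑ c, (if 0 < orient (z (p, a)) (z (q, b)) (z (r, c)) then 1 else 0) =
      m * (if 0 < orient (P p) (P q) (P r) then 1 else 0) +
      (if r = p then ((if 0 < orient (P p) (H p) (P q) then a else a.rev : Fin m) : ℕ) else 0) +
      (if r = q then ((if 0 < orient (P q) (H q) (P p) then b.rev else b : Fin m) : ℕ) else 0) := by
    by_cases hrp : r = p
    · subst hrp
      have h (c : Fin m) : 0 < orient (z (r, a)) (z (q, b)) (z (r, c)) ↔
          if 0 < orient (P r) (H r) (P q) then c < a else a < c := by
        rw [← orient_rotate, ← orient_rotate, hz.pair' hpq,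
          hQ.sub_mul_pos_iff (hH _ _ hpq)]
      simp only [h, orient_self_left, lt_irrefl, if_false, mul_zero, zero_add, if_true, if_neg hpq,
        add_zero]
      split_ifs
      · exact card_fin_lt _ _
      · exact card_fin_gt _ _
    by_cases hrq : r = q
    · subst hrq
      have h (c : Fin m) : 0 < orient (z (p, a)) (z (r, b)) (z (r, c)) ↔
          if 0 < orient (P r) (H r) (P p) then b < c else c < b := by
        rw [← orient_rotate, hz.pair' hrp, hQ.sub_mul_pos_iff (hH _ _ hrp)]
      simp only [h, orient_self_right, lt_irrefl, if_false, mul_zero, zero_add, if_true,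
        if_neg hrp]
      split_ifs
      · exact card_fin_gt _ _
      · exact card_fin_lt _ _
    · simp [hz.of_ne p q r hpq (Ne.symm hrp) (Ne.symm hrq), hrp, hrq]
  rw [leftCount, Fintype.sum_prod_type]
  simp only [hr, Finset.sum_add_distrib, ← Finset.mul_sum, Finset.sum_ite_eq', Finset.mem_univ,
    if_true]
  rfl

open Classical in
theorem IsFlatBlowup.leftCount_same (hz : IsFlatBlowup P H Q z)
    (hH : ∀ p q, p ≠ q → orient (P p) (H p) (P q) ≠ 0)
    (hQ : StrictMono fun a => Q a 0) {h : ℕ}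
    (hl : ∀ p, ∑ q, (if 0 < orient (P p) (H p) (P q) then 1 else 0) = h)
    (hr : ∀ p, ∑ q, (if orient (P p) (H p) (P q) < 0 then 1 else 0) = h)
    (p : ι) {a b : Fin m} (hab : a ≠ b) :
    leftCount z (p, a) (p, b) = m * h + leftCount Q a b := by
  have hsum (r : ι) : ∑ c, (if 0 < orient (z (p, a)) (z (p, b)) (z (r, c)) then 1 else 0) =
      m * (if (if a < b then 0 < orient (P p) (H p) (P r) else orient (P p) (H p) (P r) < 0)
        then 1 else 0) + (if r = p then leftCount Q a b else 0) := by
    by_cases hrp : r = p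
    · subst hrp
      by_cases h0 : orient (P r) (H r) (P r) = 0
      · simp [hz.same, leftCount, h0]
      · exact absurd (orient_self_left _ _) h0
    · simp only [hz.pair' (Ne.symm hrp), hQ.sub_mul_pos_iff (hH _ _ (Ne.symm hrp)), if_neg hrp,
        add_zero, Finset.sum_const, Finset.card_univ, Fintype.card_fin, smul_eq_mul]
      congr 1
      rcases lt_or_gt_of_ne hab with h1 | h1 <;>
      rcases lt_or_gt_of_ne (hH _ _ (Ne.symm hrp)) with h2 | h2 <;>
      simp [h1, h2, h1.not_gt, h2.not_gt]
  rw [leftCount, Fintype.sum_prod_type]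
  simp only [hsum, Finset.sum_add_distrib, ← Finset.mul_sum, Finset.sum_ite_eq', Finset.mem_univ,
    if_true]
  congr 2
  by_cases h1 : a < b
  · simpa only [h1, if_true] using hl p
  · simpa only [h1, if_false] using hr p

end Counting

section SideSum

variable {ι : Type*} [Fintype ι] {P H : ι → Plane} {m : ℕ} {Q : Fin m → Plane}
  {z : ι × Fin m → Plane}

theorem IsFlatBlowup.sum_of_ne (hz : IsFlatBlowup P H Q z) (hP : GenPos P)
    (hH : ∀ p q, p ≠ q → orient (P p) (H p) (P q) ≠ 0)
    (hQ : StrictMono fun a => Q a 0) {p q : ι} (hpq : p ≠ q) :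
    ∑ a, ∑ b, (leftCount z (p, a) (q, b) * leftCount z (q, b) (p, a) : ℝ) =
      m ^ 4 * (leftCount P p q * leftCount P q p) +
        m ^ 3 * (m - 1) * (Fintype.card ι - 2) + m ^ 2 * (m - 1) * (5 * m - 7) / 6 := by
  classical
  let σ : Fin m ≃ Fin m := if 0 < orient (P p) (H p) (P q) then Equiv.refl _ else Fin.revPerm
  let τ : Fin m ≃ Fin m := if 0 < orient (P q) (H q) (P p) then Fin.revPerm else Equiv.refl _
  have hrev (i : Fin m) : ((i.rev : ℕ) : ℝ) = m - 1 - (i : ℕ) := by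
    rw [Fin.val_rev, Nat.cast_sub (by omega)]; push_cast; ring
  have h1 (a b : Fin m) : (leftCount z (p, a) (q, b) : ℝ) =
      m * leftCount P p q + (σ a : ℕ) + (τ b : ℕ) := by
    rw [hz.leftCount_of_ne hH hQ hpq]
    push_cast
    simp only [σ, τ]
    split_ifs <;> rfl
  have h2 (a b : Fin m) : (leftCount z (q, b) (p, a) : ℝ) =
      m * leftCount P q p + (m - 1 - (σ a : ℕ)) + (m - 1 - (τ b : ℕ)) := by
    rw [hz.leftCount_of_ne hH hQ (Ne.symm hpq), ← hrev, ← hrev]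
    push_cast
    simp only [σ, τ]
    split_ifs <;> simp <;> ring
  simp only [h1, h2]
  rw [Equiv.sum_comp σ (fun a => ∑ b, ((m * leftCount P p q + (a : ℕ) + (τ b : ℕ)) *
    (m * leftCount P q p + (m - 1 - (a : ℕ)) + (m - 1 - (τ b : ℕ))) : ℝ))]
  have h3 (a : Fin m) := Equiv.sum_comp τ (fun b => ((m * leftCount P p q + (a : ℕ) + (b : ℕ)) *
    (m * leftCount P q p + (m - 1 - (a : ℕ)) + (m - 1 - (b : ℕ))) : ℝ))
  simp only [h3]
  rw [sum_sum_sides]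
  have h4 : (leftCount P p q : ℝ) + leftCount P q p = Fintype.card ι - 2 := by
    rw [← hP.leftCount_add hpq]; push_cast; ring
  rw [← h4]
  ring

theorem IsFlatBlowup.sum_same (hz : IsFlatBlowup P H Q z)
    (hH : ∀ p q, p ≠ q → orient (P p) (H p) (P q) ≠ 0) (hQg : GenPos Q)
    (hQ : StrictMono fun a => Q a 0) {h : ℕ}
    (hl : ∀ p, ∑ q, (if 0 < orient (P p) (H p) (P q) then 1 else 0) = h)
    (hr : ∀ p, ∑ q, (if orient (P p) (H p) (P q) < 0 then 1 else 0) = h) (p : ι) :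
    ∑ a, ∑ b, (leftCount z (p, a) (p, b) * leftCount z (p, b) (p, a) : ℝ) =
      m ^ 3 * (m - 1) * h ^ 2 + m ^ 2 * (m - 1) * (m - 2) * h + sideSum Q := by
  classical
  have h1 (a b : Fin m) : (leftCount z (p, a) (p, b) * leftCount z (p, b) (p, a) : ℝ) =
      (m ^ 2 * h ^ 2 + m * h * (m - 2)) * (1 - if a = b then 1 else 0) +
        leftCount Q a b * leftCount Q b a := by
    by_cases hab : a = b
    · subst hab
      simp [leftCount_self]
    · have h4 : (leftCount Q a b : ℝ) + leftCount Q b a = m - 2 := by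
        have := hQg.leftCount_add hab
        rw [Fintype.card_fin] at this
        have := congrArg (Nat.cast (R := ℝ)) this
        push_cast at this
        linarith
      rw [hz.leftCount_same hH hQ hl hr p hab, hz.leftCount_same hH hQ hl hr p (Ne.symm hab),
        if_neg hab, ← h4]
      push_cast
      ring
  simp only [h1, Finset.sum_add_distrib, ← Finset.mul_sum, Finset.sum_sub_distrib, sideSum]
  simp
  ring

/-- The effect of a blow-up on the sum that determines the number of crossings. -/
theorem IsFlatBlowup.sideSum_eq (hz : IsFlatBlowup P H Q z) (hP : GenPos P)
    (hH : ∀ p q, p ≠ q → orient (P p) (H p) (P q) ≠ 0) (hQg : GenPos Q)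
    (hQ : StrictMono fun a => Q a 0) {h : ℕ}
    (hl : ∀ p, ∑ q, (if 0 < orient (P p) (H p) (P q) then 1 else 0) = h)
    (hr : ∀ p, ∑ q, (if orient (P p) (H p) (P q) < 0 then 1 else 0) = h) {N : ℕ}
    (hN : Fintype.card ι = N) :
    (sideSum z : ℝ) = m ^ 4 * sideSum P +
      N * (N - 1) * (m ^ 3 * (m - 1) * (N - 2) + m ^ 2 * (m - 1) * (5 * m - 7) / 6) +
      N * (m ^ 3 * (m - 1) * h ^ 2 + m ^ 2 * (m - 1) * (m - 2) * h + sideSum Q) := by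
  classical
  have h1 (p q : ι) :
      ∑ a, ∑ b, (leftCount z (p, a) (q, b) * leftCount z (q, b) (p, a) : ℝ) =
      m ^ 4 * (leftCount P p q * leftCount P q p) +
        (m ^ 3 * (m - 1) * (N - 2) + m ^ 2 * (m - 1) * (5 * m - 7) / 6) *
          (1 - if p = q then 1 else 0) +
        (m ^ 3 * (m - 1) * h ^ 2 + m ^ 2 * (m - 1) * (m - 2) * h + sideSum Q) *
          (if p = q then 1 else 0) := by
    by_cases hpq : p = q
    · subst hpq
      rw [hz.sum_same hH hQg hQ hl hr]
      simp [leftCount_self]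
    · rw [hz.sum_of_ne hP hH hQ hpq, hN, if_neg hpq]
      ring
  have h2 : (sideSum z : ℝ) =
      ∑ p, ∑ q, ∑ a, ∑ b, (leftCount z (p, a) (q, b) * leftCount z (q, b) (p, a) : ℝ) := by
    simp only [sideSum, Fintype.sum_prod_type]
    push_cast
    exact Finset.sum_congr rfl fun p _ => Finset.sum_comm
  rw [h2]
  simp only [h1, Finset.sum_add_distrib, ← Finset.mul_sum, Finset.sum_sub_distrib]
  simp [sideSum, hN]
  ring

end SideSum

/-- There are `n` points in general position with pairwise distinct first coordinates and at most
`t * n ^ 4 / 2` crossings. -/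
def HasGoodConfig (n : ℕ) (t : ℝ) : Prop :=
  ∃ x : Fin n → Plane, GenPos x ∧ StrictMono (fun i => x i 0) ∧
    (n * (n - 1) * (n - 2) * (n - 3) / 4 : ℝ) - sideSum x ≤ t * n ^ 4

theorem cast_choose_four (n : ℕ) :
    ((n.choose 4 : ℕ) : ℝ) = n * (n - 1) * (n - 2) * (n - 3) / 24 := by
  rcases lt_or_ge n 3 with hn | hn
  · interval_cases n <;> norm_num [Nat.choose]
  · obtain ⟨k, rfl⟩ := Nat.exists_eq_add_of_le' hn
    rw [Nat.cast_choose_eq_ascPochhammer_div]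
    simp [ascPochhammer_succ_eval, Nat.factorial]
    ring

theorem hasGoodConfig_quarter (n : ℕ) : HasGoodConfig n (1 / 4) := by
  refine ⟨_, parabola_genPos n, fun i j hij => by simpa using hij, ?_⟩
  have h1 : (n * (n - 1) * (n - 2) * (n - 3) : ℝ) ≤ n ^ 4 := by
    have h : 24 * n.choose 4 ≤ n ^ 4 := by
      have := Nat.descFactorial_eq_factorial_mul_choose n 4
      have h2 := Nat.descFactorial_le_pow n 4
      simp only [Nat.factorial] at this
      omega
    have h' : (24 : ℝ) * (n.choose 4 : ℕ) ≤ n ^ 4 := by exact_mod_cast h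
    rw [cast_choose_four] at h'
    linarith
  have h2 : (0 : ℝ) ≤ sideSum (fun i : Fin n => (!₂[(i : ℝ), (i : ℝ) ^ 2] : Plane)) :=
    Nat.cast_nonneg _
  linarith

theorem leftCount_comp_equiv {ι κ : Type*} [Fintype ι] [Fintype κ] (x : ι → Plane) (e : κ ≃ ι)
    (a b : κ) : leftCount (x ∘ e) a b = leftCount x (e a) (e b) := by
  classical
  exact Equiv.sum_comp e fun c : ι => if 0 < orient (x (e a)) (x (e b)) (x c) then 1 else 0

theorem sideSum_comp_equiv {ι κ : Type*} [Fintype ι] [Fintype κ] (x : ι → Plane) (e : κ ≃ ι) :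
    sideSum (x ∘ e) = sideSum x := by
  simp only [sideSum, leftCount_comp_equiv]
  rw [← Equiv.sum_comp e fun a => ∑ b, leftCount x a b * leftCount x b a]
  exact Finset.sum_congr rfl fun a _ =>
    Equiv.sum_comp e fun b => leftCount x (e a) b * leftCount x b (e a)

theorem GenPos.comp {ι κ : Type*} {x : ι → Plane} (hx : GenPos x) {e : κ → ι}
    (he : Function.Injective e) : GenPos (x ∘ e) :=
  ⟨hx.inj.comp he, fun _ _ _ hab hac hbc =>
    hx.ne_zero _ _ _ (he.ne hab) (he.ne hac) (he.ne hbc)⟩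

theorem exists_equiv_strictMono {ι : Type*} [Fintype ι] {n : ℕ} (hn : Fintype.card ι = n)
    {f : ι → ℝ} (hf : Function.Injective f) : ∃ e : Fin n ≃ ι, StrictMono (f ∘ e) := by
  classical
  let _ : LinearOrder ι := LinearOrder.lift' f hf
  refine ⟨(Fintype.orderIsoFinOfCardEq ι hn).toEquiv, ?_⟩
  intro i j hij
  exact (Fintype.orderIsoFinOfCardEq ι hn).strictMono hij

open Classical in
theorem HasGoodConfig.blowup {ι : Type*} [Fintype ι] {P H : ι → Plane} (hP : GenPos P)
    (hPx : Function.Injective fun p => P p 0) (hHx : ∀ p, H p 0 ≠ P p 0)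
    (hH : ∀ p q, p ≠ q → orient (P p) (H p) (P q) ≠ 0) {h : ℕ}
    (hl : ∀ p, ∑ q, (if 0 < orient (P p) (H p) (P q) then 1 else 0) = h)
    (hr : ∀ p, ∑ q, (if orient (P p) (H p) (P q) < 0 then 1 else 0) = h) {N : ℕ}
    (hN : Fintype.card ι = N) (hNh : N = 2 * h + 1)
    {m : ℕ} (hm : 0 < m) {s t : ℝ} (hs : s ≤ sideSum P) (hQ : HasGoodConfig m t) :
    HasGoodConfig (N * m) (((N * (N - 1) * (N - 2) * (N - 3) / 4 - s + N * h * (h - 1) +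
      N * (N - 1) / 4 + N * h / 3 : ℝ) + N * t) / N ^ 4) := by
  obtain ⟨Q, hQg, hQm, hQs⟩ := hQ
  obtain ⟨z, hz⟩ := exists_isFlatBlowup hP hPx hHx hH hQg hQm.injective
  obtain ⟨e, he⟩ := exists_equiv_strictMono (n := N * m) (by simp [hN]) hz.x_inj
  refine ⟨z ∘ e, hz.genPos.comp e.injective, he, ?_⟩
  rw [sideSum_comp_equiv, hz.sideSum_eq hP hH hQg hQm hl hr hN]
  have hN0 : (N : ℝ) ^ 4 ≠ 0 := by
    have : (N : ℝ) ≠ 0 := by rw [hNh]; positivity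
    positivity
  have e1 (C : ℝ) : C / (N : ℝ) ^ 4 * ((N * m : ℕ) : ℝ) ^ 4 = C * m ^ 4 := by
    push_cast
    rw [mul_pow, div_mul_eq_mul_div, mul_left_comm, mul_div_cancel_left₀ _ hN0]
  rw [e1]
  have hm1 : (1 : ℝ) ≤ m := by exact_mod_cast hm
  have hh : (0 : ℝ) ≤ h * (h - 1) := by
    rcases Nat.eq_zero_or_pos h with rfl | h0
    · simp
    · have : (1 : ℝ) ≤ h := by exact_mod_cast h0
      exact mul_nonneg (by linarith) (by linarith)
  have b1 : (0 : ℝ) ≤ N * (h * (h - 1)) * m ^ 3 := by positivity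
  have b2 : (0 : ℝ) ≤ N * h / 2 * m ^ 2 * (2 * m - 1) :=
    mul_nonneg (by positivity) (by linarith)
  have b3 : (0 : ℝ) ≤ N * h / 3 * m ^ 2 * (3 * m - 2) :=
    mul_nonneg (by positivity) (by linarith)
  have b4 : (N : ℝ) * (m * (m - 1) * (m - 2) * (m - 3) / 4 - sideSum Q) ≤ N * (t * m ^ 4) := by
    gcongr
  have b5 : (m : ℝ) ^ 4 * s ≤ m ^ 4 * sideSum P := by gcongr
  have hNr : (N : ℝ) = 2 * h + 1 := by rw [hNh]; push_cast; ring
  push_cast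
  rw [hNr] at b1 b2 b3 b4 ⊢
  linarith

theorem tendsto_pow_four_div_choose :
    Tendsto (fun n : ℕ => (n : ℝ) ^ 4 / (n.choose 4 : ℝ)) atTop (𝓝 24) := by
  have h (k : ℝ) : Tendsto (fun n : ℕ => 1 - k * (n : ℝ)⁻¹) atTop (𝓝 1) := by
    simpa using (tendsto_inv_atTop_nhds_zero_nat (𝕜 := ℝ)).const_mul k |>.const_sub 1
  have h1 : Tendsto (fun n : ℕ => 24 / ((1 - 1 * (n : ℝ)⁻¹) * (1 - 2 * (n : ℝ)⁻¹) *
      (1 - 3 * (n : ℝ)⁻¹))) atTop (𝓝 24) := by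
    have := (tendsto_const_nhds (x := (24 : ℝ))).div (((h 1).mul (h 2)).mul (h 3)) (by simp)
    rwa [mul_one, mul_one, div_one] at this
  refine h1.congr' ?_
  filter_upwards [eventually_gt_atTop 3] with n hn
  have hn' : (3 : ℝ) < n := by exact_mod_cast hn
  rw [cast_choose_four]
  have p0 : (n : ℝ) ≠ 0 := by linarith
  have p1 : (n : ℝ) - 1 ≠ 0 := by linarith
  have p2 : (n : ℝ) - 2 ≠ 0 := by linarith
  have p3 : (n : ℝ) - 3 ≠ 0 := by linarith
  have q (k : ℝ) : 1 - k * (n : ℝ)⁻¹ = (n - k) / n := by field_simp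
  rw [q, q, q]
  field_simp

theorem crossing_density_limit_le {q t : ℝ} {K : ℕ} (hK : 0 < K)
    (hq : Tendsto (fun n : ℕ => (rectilinearCrossingNumber n : ℝ) / (n.choose 4 : ℝ)) atTop (𝓝 q))
    (h : ∀ m, 0 < m → HasGoodConfig (K * m) t) : q ≤ 12 * t := by
  have hs : Tendsto (fun m : ℕ => K * m) atTop atTop :=
    tendsto_id.const_mul_atTop' hK
  have h1 := hq.comp hs
  have h2 := (tendsto_pow_four_div_choose.comp hs).const_mul (t / 2)
  rw [show t / 2 * 24 = 12 * t by ring] at h2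
  refine le_of_tendsto_of_tendsto h1 h2 ?_
  filter_upwards [eventually_gt_atTop 0] with m hm
  obtain ⟨x, hx, -, hxs⟩ := h m hm
  have h3 := sideSum_add_rectilinearCrossingNumber_le hx
  rw [Fintype.card_fin] at h3
  have h4 : (sideSum x : ℝ) + 2 * rectilinearCrossingNumber (K * m) ≤
      6 * ((K * m).choose 4 : ℕ) := by exact_mod_cast h3
  have h5 := cast_choose_four (K * m)
  simp only [Function.comp_apply]
  rw [← mul_div_assoc]
  gcongr
  linarith

section Pack

/-- The number with the given list of digits in base `B`, least significant digit first. -/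
def pack (B : ℕ) : List ℕ → ℕ
  | [] => 0
  | d :: l => d + B * pack B l

variable {α : Type*}

theorem pack_map_add (B : ℕ) (f g : α → ℕ) (l : List α) :
    pack B (l.map fun c => f c + g c) = pack B (l.map f) + pack B (l.map g) := by
  induction l with
  | nil => rfl
  | cons c l ih => simp only [List.map_cons, pack, ih]; ring

theorem pack_map_mul (B k : ℕ) (f : α → ℕ) (l : List α) :
    pack B (l.map fun c => k * f c) = k * pack B (l.map f) := by
  induction l with
  | nil => rfl
  | cons c l ih => simp only [List.map_cons, pack, ih]; ring

theorem pack_map_sub (B : ℕ) {f g : α → ℕ} {l : List α} (h : ∀ c ∈ l, g c ≤ f c) :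
    pack B (l.map fun c => f c - g c) = pack B (l.map f) - pack B (l.map g) := by
  rw [eq_tsub_iff_add_eq_of_le, ← pack_map_add]
  · congr 1
    exact List.map_congr_left fun c hc => Nat.sub_add_cancel (h c hc)
  · induction l with
    | nil => rfl
    | cons c l ih =>
      simp only [List.map_cons, pack]
      exact Nat.add_le_add (h c (by simp))
        (Nat.mul_le_mul_left _ (ih fun d hd => h d (by simp [hd])))

theorem pack_modEq (W : ℕ) (l : List ℕ) : pack (2 ^ W) l ≡ l.sum [MOD (2 ^ W - 1)] := by
  induction l with
  | nil => rfl
  | cons d l ih =>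
    simp only [pack, List.sum_cons]
    refine Nat.ModEq.add_left d ?_
    have h : 2 ^ W ≡ 1 [MOD (2 ^ W - 1)] :=
      ((Nat.modEq_iff_dvd' Nat.one_le_two_pow).2 dvd_rfl).symm
    simpa using h.mul ih

theorem add_mul_land_add_mul {W x u : ℕ} (hx : x < 2 ^ W) (hu : u < 2 ^ W) (y v : ℕ) :
    (x + 2 ^ W * y) &&& (u + 2 ^ W * v) = (x &&& u) + 2 ^ W * (y &&& v) := by
  have h : (x &&& u) < 2 ^ W := Nat.and_lt_two_pow x hu
  rw [add_comm x, add_comm u, add_comm (x &&& u)]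
  refine Nat.eq_of_testBit_eq fun i => ?_
  rw [Nat.testBit_and, Nat.testBit_two_pow_mul_add _ hx, Nat.testBit_two_pow_mul_add _ hu,
    Nat.testBit_two_pow_mul_add _ h]
  split_ifs <;> rw [Nat.testBit_and]

theorem pack_land {W k : ℕ} (hk : k < W) {l : List ℕ} (hl : ∀ d ∈ l, d < 2 ^ W) :
    pack (2 ^ W) l &&& pack (2 ^ W) (l.map fun _ => 2 ^ k) =
      pack (2 ^ W) (l.map fun d => d &&& 2 ^ k) := by
  induction l with
  | nil => simp [pack]
  | cons d l ih =>
    simp only [List.map_cons, pack]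
    rw [add_mul_land_add_mul (hl d (by simp)) (Nat.pow_lt_pow_right (by norm_num) hk),
      ih fun d hd => hl d (by simp [hd])]

theorem land_two_pow_of_lt {k d : ℕ} (hd : d < 2 ^ (k + 1)) :
    d &&& 2 ^ k = 2 ^ k * if 2 ^ k ≤ d then 1 else 0 := by
  rw [Nat.and_two_pow, Nat.testBit_eq_decide_div_mod_eq, mul_comm]
  congr 1
  split_ifs with h
  · have h1 : d / 2 ^ k = 1 := by
      rw [Nat.div_eq_iff (by positivity)]
      rw [pow_succ] at hd
      omega
    simp [h1]
  · rw [Nat.div_eq_of_lt (by omega)]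
    rfl

/-- The number of digits that are at least `2 ^ k`, computed with few arithmetic operations. -/
def countDigits (W k S mask : ℕ) : ℕ := (S &&& mask) % (2 ^ W - 1) / 2 ^ k

theorem countDigits_pack {W k : ℕ} (hk : k < W) {l : List ℕ} (hl : ∀ d ∈ l, d < 2 ^ (k + 1))
    (hlen : l.length * 2 ^ k < 2 ^ W - 1) :
    countDigits W k (pack (2 ^ W) l) (pack (2 ^ W) (l.map fun _ => 2 ^ k)) =
      (l.map fun d => if 2 ^ k ≤ d then 1 else 0).sum := by
  have h1 : l.map (fun d => d &&& 2 ^ k) = l.map fun d => 2 ^ k * if 2 ^ k ≤ d then 1 else 0 :=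
    List.map_congr_left fun d hd => land_two_pow_of_lt (hl d hd)
  have h2 : (l.map fun d => if 2 ^ k ≤ d then 1 else 0).sum ≤ l.length := by
    have := List.sum_le_card_nsmul (l.map fun d => if 2 ^ k ≤ d then 1 else 0) 1 (by
      simp only [List.mem_map]
      rintro _ ⟨d, -, rfl⟩
      split_ifs <;> simp)
    simpa using this
  rw [countDigits, pack_land hk fun d hd => (hl d hd).trans_le
    (Nat.pow_le_pow_right (by norm_num) hk), pack_modEq, h1, List.sum_map_mul_left,
    Nat.mod_eq_of_lt, Nat.mul_div_cancel_left _ (by positivity)]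
  calc _ ≤ 2 ^ k * l.length := Nat.mul_le_mul_left _ h2
    _ < _ := by rw [mul_comm]; exact hlen

end Pack

section Certificate

/-- The point with the given natural coordinates. -/
noncomputable def natPoint (a : ℕ × ℕ) : Plane := !₂[(a.1 : ℝ), (a.2 : ℝ)]

/-- The packed coordinates of a list of points: first coordinates, second coordinates, ones. -/
structure Packed where
  xs : ℕ
  ys : ℕ
  ones : ℕ

/-- The packed coordinates of the points of a list, with digits in base `2 ^ W`. -/
def packPoints (W : ℕ) (l : List (ℕ × ℕ)) : Packed where
  xs := pack (2 ^ W) (l.map fun c => c.1)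
  ys := pack (2 ^ W) (l.map fun c => c.2)
  ones := pack (2 ^ W) (l.map fun _ => 1)

/-- The number of points `c` of a packed list with `orient a b c + t ≥ 2 ^ k`. -/
def countOrient (W k : ℕ) (p : Packed) (t : ℕ) (a b : ℕ × ℕ) : ℕ :=
  countDigits W k ((b.1 * p.ys + (a.2 * p.xs + (a.1 * b.2 + t) * p.ones)) -
    (b.2 * p.xs + (a.1 * p.ys + a.2 * b.1 * p.ones))) (2 ^ k * p.ones)

theorem orient_natPoint (a b c : ℕ × ℕ) :
    orient (natPoint a) (natPoint b) (natPoint c) =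
      (b.1 * c.2 + (a.2 * c.1 + a.1 * b.2) : ℕ) - (b.2 * c.1 + (a.1 * c.2 + a.2 * b.1) : ℕ) := by
  simp [orient, natPoint]; ring

variable {W k C : ℕ} {l : List (ℕ × ℕ)}

theorem countOrient_eq (hk : k < W) (hlen : l.length * 2 ^ k < 2 ^ W - 1) (hC : 3 * C ^ 2 < 2 ^ k)
    (hl : ∀ c ∈ l, c.1 ≤ C ∧ c.2 ≤ C) {a b : ℕ × ℕ} (ha : a.1 ≤ C ∧ a.2 ≤ C)
    (hb : b.1 ≤ C ∧ b.2 ≤ C) {t : ℕ} (ht : t ≤ 2 ^ k) (ht' : 2 ^ k ≤ t + 1) :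
    countOrient W k (packPoints W l) t a b =
      (l.map fun c => if b.2 * c.1 + (a.1 * c.2 + a.2 * b.1) + 2 ^ k ≤
        b.1 * c.2 + (a.2 * c.1 + a.1 * b.2) + t then 1 else 0).sum := by
  have bound (c) (hc : c ∈ l) : b.2 * c.1 + (a.1 * c.2 + a.2 * b.1) ≤ 3 * C ^ 2 ∧
      b.1 * c.2 + (a.2 * c.1 + a.1 * b.2) ≤ 3 * C ^ 2 := by
    obtain ⟨h1, h2⟩ := hl c hc
    constructor
    · nlinarith [Nat.mul_le_mul hb.2 h1, Nat.mul_le_mul ha.1 h2, Nat.mul_le_mul ha.2 hb.1]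
    · nlinarith [Nat.mul_le_mul hb.1 h2, Nat.mul_le_mul ha.2 h1, Nat.mul_le_mul ha.1 hb.2]
  have e1 : b.1 * (packPoints W l).ys + (a.2 * (packPoints W l).xs +
      (a.1 * b.2 + t) * (packPoints W l).ones) - (b.2 * (packPoints W l).xs +
        (a.1 * (packPoints W l).ys + a.2 * b.1 * (packPoints W l).ones)) =
      pack (2 ^ W) (l.map fun c => (b.1 * c.2 + (a.2 * c.1 + (a.1 * b.2 + t) * 1)) -
        (b.2 * c.1 + (a.1 * c.2 + a.2 * b.1 * 1))) := by
    rw [pack_map_sub, pack_map_add, pack_map_add, pack_map_add, pack_map_add]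
    · simp only [pack_map_mul]
      rfl
    · intro c hc
      have := (bound c hc).1
      omega
  have e2 : 2 ^ k * (packPoints W l).ones = pack (2 ^ W)
      ((l.map fun c => (b.1 * c.2 + (a.2 * c.1 + (a.1 * b.2 + t) * 1)) -
        (b.2 * c.1 + (a.1 * c.2 + a.2 * b.1 * 1))).map fun _ => 2 ^ k) := by
    rw [List.map_map, packPoints, ← pack_map_mul]
    simp only [mul_one]
    rfl
  rw [countOrient, e1, e2, countDigits_pack hk _ (by simpa using hlen), List.map_map]
  · congr 1
    refine List.map_congr_left fun c hc => ?_
    have := (bound c hc).1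
    simp only [Function.comp_apply, mul_one]
    congr 1
    refine propext ⟨fun h => ?_, fun h => ?_⟩ <;> omega
  · intro d hd
    obtain ⟨c, hc, rfl⟩ := List.mem_map.1 hd
    have := (bound c hc).2
    rw [pow_succ]
    omega

theorem sum_map_eq_sum_fin {α : Type*} (l : List α) (f : α → ℕ) :
    (l.map f).sum = ∑ i : Fin l.length, f (l.get i) := by
  induction l with
  | nil => rfl
  | cons a l ih =>
    rw [List.map_cons, List.sum_cons, ih]
    exact (Fin.sum_univ_succ fun i : Fin (l.length + 1) => f ((a :: l).get i)).symm

variable {data : List ((ℕ × ℕ) × (ℕ × ℕ))}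

open Classical in
theorem countOrient_nonneg (hk : k < W) (hlen : data.length * 2 ^ k < 2 ^ W - 1)
    (hC : 3 * C ^ 2 < 2 ^ k) (hl : ∀ c ∈ data, c.1.1 ≤ C ∧ c.1.2 ≤ C) {a b : ℕ × ℕ}
    (ha : a.1 ≤ C ∧ a.2 ≤ C) (hb : b.1 ≤ C ∧ b.2 ≤ C) :
    countOrient W k (packPoints W (data.map Prod.fst)) (2 ^ k) a b = ∑ i : Fin data.length,
      if 0 ≤ orient (natPoint a) (natPoint b) (natPoint (data.get i).1) then 1 else 0 := by
  rw [countOrient_eq hk (by simpa using hlen) hC (by simpa using hl) ha hb le_rfl (Nat.le_succ _),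
    List.map_map, sum_map_eq_sum_fin]
  refine Finset.sum_congr rfl fun i _ => if_congr ?_ rfl rfl
  rw [orient_natPoint, sub_nonneg, Nat.cast_le]
  omega

open Classical in
theorem countOrient_pos (hk : k < W) (hlen : data.length * 2 ^ k < 2 ^ W - 1)
    (hC : 3 * C ^ 2 < 2 ^ k) (hl : ∀ c ∈ data, c.1.1 ≤ C ∧ c.1.2 ≤ C) {a b : ℕ × ℕ}
    (ha : a.1 ≤ C ∧ a.2 ≤ C) (hb : b.1 ≤ C ∧ b.2 ≤ C) :
    countOrient W k (packPoints W (data.map Prod.fst)) (2 ^ k - 1) a b = ∑ i : Fin data.length,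
      if 0 < orient (natPoint a) (natPoint b) (natPoint (data.get i).1) then 1 else 0 := by
  have : 0 < 2 ^ k := by positivity
  rw [countOrient_eq hk (by simpa using hlen) hC (by simpa using hl) ha hb (by omega) (by omega),
    List.map_map, sum_map_eq_sum_fin]
  refine Finset.sum_congr rfl fun i _ => if_congr ?_ rfl rfl
  rw [orient_natPoint, sub_pos, Nat.cast_lt]
  omega

end Certificate

section Lists

variable {α : Type*}

/-- Whether `f` holds for all pairs of entries of a list, in the order of the list. -/
def allPairs (f : α → α → Bool) : List α → Bool
  | [] => true
  | a :: l => l.all (f a) && allPairs f l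

/-- The sum of `f` over all pairs of entries of a list, in the order of the list. -/
def sumPairs (f : α → α → ℕ) : List α → ℕ
  | [] => 0
  | a :: l => (l.map (f a)).sum + sumPairs f l

theorem allPairs_eq_true {f : α → α → Bool} {l : List α} :
    allPairs f l = true ↔ l.Pairwise fun a b => f a b = true := by
  induction l with
  | nil => simp [allPairs]
  | cons a l ih => simp [allPairs, ih]

theorem sumPairs_congr {f g : α → α → ℕ} {l : List α} (h : l.Pairwise fun a b => f a b = g a b) :
    sumPairs f l = sumPairs g l := by
  induction l with
  | nil => rfl
  | cons a l ih =>
    rw [List.pairwise_cons] at h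
    rw [sumPairs, sumPairs, ih h.2, List.map_congr_left h.1]

theorem sum_sum_eq_two_mul_sumPairs {f : α → α → ℕ} (hf : ∀ a b, f a b = f b a)
    (h0 : ∀ a, f a a = 0) (l : List α) :
    (l.map fun a => (l.map (f a)).sum).sum = 2 * sumPairs f l := by
  induction l with
  | nil => rfl
  | cons a l ih =>
    simp only [List.map_cons, List.sum_cons, List.sum_map_add, ih, sumPairs, h0, fun b => hf b a]
    ring

end Lists

open Classical in
theorem sum_nonneg_eq {ι : Type*} [Fintype ι] (f : ι → ℝ) :
    ∑ i, (if 0 ≤ f i then 1 else 0) =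
      ∑ i, (if 0 < f i then 1 else 0) + (Finset.univ.filter fun i => f i = 0).card := by
  rw [Finset.card_filter, ← Finset.sum_add_distrib]
  refine Finset.sum_congr rfl fun i _ => ?_
  rcases lt_trichotomy (f i) 0 with h | h | h
  · simp [h.not_ge, h.not_gt, h.ne]
  · simp [h]
  · simp [h, h.le, h.ne']

open Classical in
theorem sum_neg_add_sum_nonneg {ι : Type*} [Fintype ι] (f : ι → ℝ) :
    ∑ i, (if f i < 0 then 1 else 0) + ∑ i, (if 0 ≤ f i then 1 else 0) = Fintype.card ι := by
  rw [← Finset.sum_add_distrib, ← Finset.card_univ, Finset.card_eq_sum_ones]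
  refine Finset.sum_congr rfl fun i _ => ?_
  rcases lt_or_ge (f i) 0 with h | h
  · simp [h, h.not_ge]
  · simp [h, h.not_gt]

/-- A computable condition under which a list of points, each with a second point that determines
a line through it, is in general position, has all its lines halving, and has a given sum of
products of side counts. -/
structure IsHalvedConfig (W k C h s : ℕ) (data : List ((ℕ × ℕ) × (ℕ × ℕ))) : Prop where
  lt : k < W
  length_lt : data.length * 2 ^ k < 2 ^ W - 1
  bound : 3 * C ^ 2 < 2 ^ k
  le : (data.all fun c => Nat.ble c.1.1 C && (Nat.ble c.1.2 C && (Nat.ble c.2.1 C &&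
    (Nat.ble c.2.2 C && !Nat.beq c.1.1 c.2.1)))) = true
  pairs : allPairs (fun c d => !Nat.ble d.1.1 c.1.1 &&
    Nat.beq (countOrient W k (packPoints W (data.map Prod.fst)) (2 ^ k) c.1 d.1)
      (countOrient W k (packPoints W (data.map Prod.fst)) (2 ^ k - 1) c.1 d.1 + 2)) data = true
  halving : (data.all fun c =>
    Nat.beq (countOrient W k (packPoints W (data.map Prod.fst)) (2 ^ k) c.1 c.2) (h + 1) &&
    Nat.beq (countOrient W k (packPoints W (data.map Prod.fst)) (2 ^ k - 1) c.1 c.2) h) = true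
  length_eq : data.length = 2 * h + 1
  sum_eq : sumPairs (fun c d =>
    countOrient W k (packPoints W (data.map Prod.fst)) (2 ^ k - 1) c.1 d.1 *
      (2 * h - 1 - countOrient W k (packPoints W (data.map Prod.fst)) (2 ^ k - 1) c.1 d.1)) data = s

theorem IsHalvedConfig.hasGoodConfig {W k C h s : ℕ} {data : List ((ℕ × ℕ) × (ℕ × ℕ))}
    (hd : IsHalvedConfig W k C h s data) {N : ℕ} (hN : N = 2 * h + 1) {m : ℕ} (hm : 0 < m) {t : ℝ}
    (hQ : HasGoodConfig m t) :
    HasGoodConfig (N * m) (((N * (N - 1) * (N - 2) * (N - 3) / 4 - 2 * s + N * h * (h - 1) +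
      N * (N - 1) / 4 + N * h / 3 : ℝ) + N * t) / N ^ 4) := by
  classical
  obtain ⟨hk, hlen, hC, hle, hpairs, hhalf, hlength, hsum⟩ := hd
  simp only [List.all_eq_true, Bool.and_eq_true, Nat.ble_eq, Nat.beq_eq, Bool.not_eq_true',
    ← Bool.not_eq_true] at hle hhalf
  rw [allPairs_eq_true] at hpairs
  simp only [Bool.and_eq_true, Nat.ble_eq, Nat.beq_eq, Bool.not_eq_true',
    ← Bool.not_eq_true, not_le] at hpairs
  have hl : ∀ c ∈ data, c.1.1 ≤ C ∧ c.1.2 ≤ C := fun c hc => ⟨(hle c hc).1, (hle c hc).2.1⟩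
  let P : Fin data.length → Plane := fun i => natPoint (data.get i).1
  let H : Fin data.length → Plane := fun i => natPoint (data.get i).2
  have hcard : Fintype.card (Fin data.length) = N := by rw [Fintype.card_fin, hlength, hN]
  have hmem (i : Fin data.length) : data.get i ∈ data := List.get_mem _ _
  have hpairs' : ∀ i j : Fin data.length, i < j → (data.get i).1.1 < (data.get j).1.1 ∧
      (Finset.univ.filter fun r => orient (P i) (P j) (P r) = 0).card = 2 := by
    intro i j hij
    obtain ⟨h1, h2⟩ := List.pairwise_iff_get.1 hpairs i j hij
    refine ⟨h1, ?_⟩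
    rw [countOrient_nonneg hk hlen hC hl (hl _ (hmem i)) (hl _ (hmem j)),
      countOrient_pos hk hlen hC hl (hl _ (hmem i)) (hl _ (hmem j)), sum_nonneg_eq] at h2
    exact Nat.add_left_cancel h2
  have hx : StrictMono fun i => P i 0 := by
    intro i j hij
    simpa [P, natPoint] using (hpairs' i j hij).1
  have hne_lt {i j r : Fin data.length} (hij : i < j) (hri : i ≠ r) (hrj : j ≠ r) :
      orient (P i) (P j) (P r) ≠ 0 := by
    intro h0
    have h1 : ({i, j, r} : Finset (Fin data.length)) ⊆
        Finset.univ.filter fun r => orient (P i) (P j) (P r) = 0 := by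
      intro u hu
      simp only [Finset.mem_insert, Finset.mem_singleton] at hu
      simp only [Finset.mem_filter, Finset.mem_univ, true_and]
      rcases hu with rfl | rfl | rfl
      · exact orient_self_left _ _
      · exact orient_self_right _ _
      · exact h0
    have h2 := Finset.card_le_card h1
    rw [(hpairs' i j hij).2, Finset.card_eq_three.2 ⟨i, j, r, hij.ne, hri, hrj, rfl⟩] at h2
    omega
  have hP : GenPos P := by
    refine ⟨fun i j hij => hx.injective (congrArg (fun p : Plane => p 0) hij), ?_⟩
    intro i j r hij hir hjr
    rcases lt_or_gt_of_ne hij with h1 | h1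
    · exact hne_lt h1 hir hjr
    · rw [← neg_ne_zero, ← orient_swap]
      exact hne_lt h1 hjr hir
  have hHx (i) : H i 0 ≠ P i 0 := by
    have := (hle _ (hmem i)).2.2.2.2
    simp only [P, H, natPoint]
    simpa using Ne.symm this
  have hz (i : Fin data.length) :
      ∑ r, (if 0 ≤ orient (P i) (H i) (P r) then 1 else 0) = h + 1 ∧
      ∑ r, (if 0 < orient (P i) (H i) (P r) then 1 else 0) = h := by
    have h1 := hle _ (hmem i)
    have h2 := hhalf _ (hmem i)
    rwa [countOrient_nonneg hk hlen hC hl (hl _ (hmem i)) ⟨h1.2.2.1, h1.2.2.2.1⟩,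
      countOrient_pos hk hlen hC hl (hl _ (hmem i)) ⟨h1.2.2.1, h1.2.2.2.1⟩] at h2
  have hH (i j) (hij : i ≠ j) : orient (P i) (H i) (P j) ≠ 0 := by
    intro h0
    have h1 : ({i, j} : Finset (Fin data.length)) ⊆
        Finset.univ.filter fun r => orient (P i) (H i) (P r) = 0 := by
      intro u hu
      simp only [Finset.mem_insert, Finset.mem_singleton] at hu
      simp only [Finset.mem_filter, Finset.mem_univ, true_and]
      rcases hu with rfl | rfl
      · exact orient_self_left _ _
      · exact h0
    have h2 := Finset.card_le_card h1
    have h3 := sum_nonneg_eq fun r => orient (P i) (H i) (P r)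
    rw [Finset.card_pair hij] at h2
    have h4 := hz i
    omega
  have hr (i) : ∑ j, (if orient (P i) (H i) (P j) < 0 then 1 else 0) = h := by
    have h1 := sum_neg_add_sum_nonneg fun r => orient (P i) (H i) (P r)
    have h2 := hz i
    omega
  have hside : sideSum P = 2 * s := by
    have hcount (i j : Fin data.length) :
        countOrient W k (packPoints W (data.map Prod.fst)) (2 ^ k - 1) (data.get i).1
          (data.get j).1 = leftCount P i j :=
      countOrient_pos hk hlen hC hl (hl _ (hmem i)) (hl _ (hmem j))
    let f : (ℕ × ℕ) × (ℕ × ℕ) → (ℕ × ℕ) × (ℕ × ℕ) → ℕ := fun c d =>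
      (∑ i, if 0 < orient (natPoint c.1) (natPoint d.1) (P i) then 1 else 0) *
        ∑ i, if 0 < orient (natPoint d.1) (natPoint c.1) (P i) then 1 else 0
    have hf : sumPairs f data = s := by
      rw [← hsum]
      refine sumPairs_congr (List.pairwise_iff_get.2 fun i j hij => ?_)
      rw [hcount]
      have h1 := hP.leftCount_add hij.ne
      rw [Fintype.card_fin] at h1
      replace h1 := h1.trans hlength
      rw [show 2 * h - 1 - leftCount P i j = leftCount P j i by omega]
      rfl
    rw [← hf, ← sum_sum_eq_two_mul_sumPairs (fun c d => mul_comm _ _)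
      (fun c => by simp [orient_self]), sum_map_eq_sum_fin]
    refine Finset.sum_congr rfl fun i _ => ?_
    rw [sum_map_eq_sum_fin]
    rfl
  have := hQ.blowup hP hx.injective hHx hH (fun i => (hz i).2) hr hcard hN hm
    (s := 2 * s) (by rw [hside]; push_cast; exact le_rfl)
  exact this

theorem IsHalvedConfig.limit_le {W k C h s : ℕ} {data : List ((ℕ × ℕ) × (ℕ × ℕ))}
    (hd : IsHalvedConfig W k C h s data) {N : ℕ} (hN : N = 2 * h + 1) {q : ℝ}
    (hq : Tendsto (fun n : ℕ => (rectilinearCrossingNumber n : ℝ) / (n.choose 4 : ℝ)) atTop (𝓝 q)) :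
    q ≤ 12 * (((N * (N - 1) * (N - 2) * (N - 3) / 4 - 2 * s + N * h * (h - 1) +
      N * (N - 1) / 4 + N * h / 3 : ℝ) + N * (((N * (N - 1) * (N - 2) * (N - 3) / 4 - 2 * s +
        N * h * (h - 1) + N * (N - 1) / 4 + N * h / 3 : ℝ) + N * (1 / 4)) / N ^ 4)) / N ^ 4) := by
  have hN0 : 0 < N := by omega
  refine crossing_density_limit_le (K := N * N) (by positivity) hq fun m hm => ?_
  rw [mul_assoc]
  exact hd.hasGoodConfig hN (by positivity) (hd.hasGoodConfig hN hm (hasGoodConfig_quarter m))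

/-- 195 points with few crossings, each with a second point on a halving line through it. -/
def halvedPoints : List ((ℕ × ℕ) × (ℕ × ℕ)) :=
  [((1000000, 6347164), (1028145, 6357548)), ((1632878, 6580669), (1634754, 6581362)),
    ((1692278, 6602572), (1692297, 6602579)), ((1813410, 6647408), (1814348, 6647755)),
    ((2089707, 6749027), (2090646, 6749370)), ((2106429, 6755131), (2106617, 6755200)),
    ((2172739, 6780355), (2172926, 6780426)), ((2179520, 6782921), (2179614, 6782956)),
    ((2400250, 6863075), (2400437, 6863147)), ((2849587, 7026324), (2854284, 7028038)),
    ((2864555, 7032192), (2866435, 7032873)), ((3369836, 7230267), (3370025, 7230334)),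
    ((3787039, 7393803), (3796349, 7397452)), ((3980933, 7469877), (3980980, 7469893)),
    ((4156928, 7538898), (4156975, 7538916)), ((4386649, 7629017), (4386742, 7629053)),
    ((4504673, 7675108), (4506534, 7675840)), ((4529217, 7684693), (4529683, 7684875)),
    ((5330253, 7931061), (5330442, 7931126)), ((5336418, 7933200), (5336890, 7933364)),
    ((5424939, 7960449), (5424948, 7960452)), ((5434375, 7963387), (5434470, 7963418)),
    ((5453462, 7969234), (5453481, 7969240)), ((5468412, 7973770), (5468883, 7973936)),
    ((8813647, 9363275), (8818267, 9365186)), ((8835474, 9372304), (8837322, 9373069)),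
    ((8916705, 9405947), (8916751, 9405966)), ((8995381, 9438426), (8997230, 9439189)),
    ((9109739, 9485887), (9110231, 9485975)), ((9176235, 9513482), (9176328, 9513520)),
    ((9227177, 9534251), (9227182, 9534253)), ((9258334, 9547085), (9258519, 9547162)),
    ((9350986, 9585928), (9351078, 9585967)), ((10444343, 9724309), (10444348, 9724310)),
    ((10452805, 9725775), (10452825, 9725778)), ((10454304, 9725956), (10454314, 9725957)),
    ((10482434, 9732289), (10482429, 9732289)), ((10484998, 9732866), (10485096, 9732887)),
    ((11314840, 9795364), (11314890, 9795368)), ((11434593, 9827556), (11434641, 9827569)),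
    ((11799370, 9926465), (11799563, 9926518)), ((11981182, 9973614), (11981281, 9973630)),
    ((12018495, 9983379), (12018514, 9983384)), ((12598105, 10135706), (12598269, 10135821)),
    ((12634075, 10142568), (12634085, 10142571)), ((13383012, 10365099), (13383204, 10365156)),
    ((13392688, 10367786), (13393170, 10367920)), ((13474839, 10391776), (13474887, 10391790)),
    ((13566620, 10418290), (13565639, 10418482)), ((15277761, 12019967), (15277849, 12020014)),
    ((15280582, 12021448), (15280586, 12021450)), ((15285416, 12024082), (15285592, 12024177)),
    ((15313229, 12041396), (15313233, 12041399)), ((15330077, 12051688), (15330151, 12051755)),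
    ((15403691, 12095042), (15404141, 12095260)), ((15408198, 12099407), (15408378, 12099494)),
    ((15409300, 12100474), (15409444, 12100613)), ((15416336, 12107291), (15416505, 12107398)),
    ((15417625, 12108518), (15417667, 12108545)), ((15419511, 12110368), (15419526, 12110382)),
    ((15420061, 12110840), (15420102, 12110868)), ((16329610, 11068696), (16330095, 11068818)),
    ((16330014, 11068235), (16330209, 11068281)), ((16330232, 11067985), (16330281, 11067997)),
    ((16330334, 11067871), (16330321, 11067887)), ((17560722, 9656385), (17560713, 9656389)),
    ((17561194, 9656307), (17561144, 9656311)), ((17563044, 9656271), (17563035, 9656276)),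
    ((17564271, 9656209), (17564228, 9656234)), ((17571088, 9655990), (17570888, 9655997)),
    ((17572155, 9655955), (17572141, 9655970)), ((17576520, 9655813), (17576479, 9655841)),
    ((17619874, 9625553), (17619775, 9625564)), ((17630166, 9618997), (17630161, 9618998)),
    ((17647480, 9608498), (17647442, 9608530)), ((17650114, 9606298), (17650107, 9606305)),
    ((17651595, 9604958), (17651580, 9604971)), ((18061935, 13341228), (18061944, 13341232)),
    ((18062151, 13341330), (18062272, 13341490)), ((18062619, 13341548), (18062622, 13341552)),
    ((18063484, 13341952), (18064083, 13342752)), ((18602866, 11608078), (18602707, 11608552)),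
    ((18603327, 11608943), (18603268, 11609134)), ((18603577, 11609411), (18603574, 11609421)),
    ((18603691, 11609627), (18603696, 11609636)), ((19253272, 9495494), (19252895, 9496420)),
    ((19279786, 9430227), (19279784, 9430232)), ((19303776, 9372066), (19303740, 9372159)),
    ((19306463, 9365077), (19306444, 9365123)), ((19528994, 8838671), (19528955, 8838763)),
    ((19535856, 8809563), (19535396, 8809759)), ((19688183, 8382280), (19688167, 8382327)),
    ((19697948, 8354732), (19697781, 8355203)), ((19745097, 8220069), (19745079, 8220116)),
    ((19844006, 7954201), (19843999, 7954220)), ((19876198, 7866640), (19876181, 7866839)),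
    ((19938696, 7099296), (19938683, 7099344)), ((19939273, 7097309), (19939272, 7097329)),
    ((19945606, 7075512), (19945605, 7075522)), ((19945787, 7074194), (19945786, 7074199)),
    ((19947253, 7067198), (19947248, 7067217)), ((20015177, 14251501), (20015183, 14251520)),
    ((20015255, 14252051), (20015259, 14252101)), ((20015291, 14253937), (20015292, 14253957)),
    ((20015353, 14255226), (20015356, 14255326)), ((20015572, 14262262), (20015579, 14262462)),
    ((20015607, 14263364), (20015653, 14263453)), ((20015749, 14267871), (20015824, 14268056)),
    ((20046009, 14341485), (20046010, 14341495)), ((20052565, 14358333), (20052566, 14358338)),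
    ((20063064, 14386146), (20063106, 14386237)), ((20065264, 14390980), (20065266, 14390984)),
    ((20066604, 14393801), (20066606, 14393806)), ((20085634, 6112222), (20085631, 6112226)),
    ((20124477, 6058413), (20124419, 6058494)), ((20137311, 6040090), (20137283, 6040132)),
    ((20158080, 6009917), (20157966, 6010082)), ((20176068, 16104942), (20176358, 16105350)),
    ((20185675, 5971016), (20185462, 5971993)), ((20233136, 5904119), (20232561, 5904937)),
    ((20241335, 16196723), (20241346, 16196822)), ((20265615, 5857922), (20264464, 5859558)),
    ((20299258, 5810334), (20299229, 5810375)), ((20299496, 16278874), (20299613, 16279036)),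
    ((20306485, 16288550), (20306514, 16288591)), ((20308287, 5797536), (20305405, 5801622)),
    ((20832891, 17037487), (20833006, 17037651)), ((20861999, 17073457), (20862002, 17073467)),
    ((21289282, 17653067), (21289401, 17653227)), ((21316830, 17690380), (21316889, 17690460)),
    ((21451493, 17872192), (21451522, 17872232)), ((21697792, 3841806), (21697768, 3841850)),
    ((21702328, 3831392), (21702323, 3831401)), ((21708175, 3818152), (21708153, 3818197)),
    ((21711113, 3811654), (21711111, 3811658)), ((21717361, 18236969), (21717656, 18237373)),
    ((21738362, 3750382), (21738127, 3750823)), ((21740501, 3746356), (21740478, 3746400)),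
    ((21804922, 18356722), (21805261, 18357090)), ((21986869, 3191688), (21986842, 3191730)),
    ((21996454, 3176729), (21996345, 3176897)), ((22042545, 3104796), (22042534, 3104813)),
    ((22132664, 2965194), (22132659, 2965202)), ((22201685, 2858220), (22201639, 2858309)),
    ((22277759, 2740400), (22272341, 2748805)), ((22441295, 2486733), (22440332, 2488486)),
    ((22572266, 19186564), (22572328, 19186643)), ((22574253, 19189128), (22574260, 19189135)),
    ((22596050, 19217258), (22596084, 19217295)), ((22597368, 19218757), (22597381, 19218772)),
    ((22604364, 19227219), (22604395, 19227258)), ((22639370, 2179527), (22639123, 2179962)),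
    ((22645238, 2170427), (22644740, 2171294)), ((22808487, 1884339), (22808381, 1884508)),
    ((22888641, 1743763), (22888631, 1743780)), ((22891207, 1739548), (22891181, 1739591)),
    ((22916431, 1698462), (22916406, 1698505)), ((22922535, 1687844), (22922286, 1688277)),
    ((23024154, 1513166), (23024053, 1513338)), ((23068990, 1436870), (23068738, 1437302)),
    ((23090893, 1399373), (23090792, 1399546)), ((23324398, 1000000), (23309256, 1025898)),
    ((23559340, 20320576), (23559390, 20320663)), ((23613149, 20413228), (23613174, 20413271)),
    ((23631472, 20444385), (23631482, 20444402)), ((23661645, 20495327), (23662154, 20496188)),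
    ((23700546, 20561823), (23700578, 20561862)), ((23767443, 20676181), (23767544, 20676353)),
    ((23813640, 20754857), (23813893, 20755288)), ((23861228, 20836088), (23861734, 20836951)),
    ((23874026, 20857915), (23876555, 20862228)), ((25829756, 24203150), (25829767, 24203167)),
    ((25840170, 24218100), (25840197, 24218142)), ((25853410, 24237187), (25853466, 24237270)),
    ((25859908, 24246623), (25859936, 24246665)), ((25921180, 24335144), (25922273, 24336819)),
    ((25925206, 24341309), (25925261, 24341393)), ((26479874, 25142345), (26480134, 25142772)),
    ((26494833, 25166889), (26495092, 25167316)), ((26566766, 25284913), (26566818, 25284998)),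
    ((26706368, 25514634), (26706473, 25514804)), ((26813342, 25690629), (26813452, 25690796)),
    ((26931162, 25884523), (26936357, 25893067)), ((27184829, 26301726), (27187541, 26305927)),
    ((27492035, 26807007), (27494724, 26811222)), ((27501135, 26821975), (27503816, 26826196)),
    ((27787223, 27271312), (27787485, 27271738)), ((27927799, 27492042), (27927804, 27492050)),
    ((27932014, 27498823), (27932040, 27498865)), ((27973100, 27565133), (27973207, 27565302)),
    ((27983718, 27581855), (27984790, 27583544)), ((28158396, 27858152), (28158929, 27858998)),
    ((28234692, 27979284), (28234959, 27979707)), ((28272189, 28038684), (28273256, 28040376)),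
    ((28671562, 28671562), (28724929, 28756131))]

theorem halvedPoints_isHalvedConfig : IsHalvedConfig 60 52 29671562 97 153221922 halvedPoints where
  lt := by decide +kernel
  length_lt := by decide +kernel
  bound := by decide +kernel
  le := by decide +kernel
  pairs := by decide +kernel
  halving := by decide +kernel
  length_eq := by decide +kernel
  sum_eq := by decide +kernel

theorem theorem6 :
    ∃ q : ℝ,
      Tendsto (fun n : ℕ => (rectilinearCrossingNumber n : ℝ) / (n.choose 4 : ℝ)) atTop (𝓝 q) ∧
      q ≤ 83247328 / 218791125 ∧
      (83247328 / 218791125 : ℝ) < 0.380488 := by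
  obtain ⟨q, hq⟩ := exists_tendsto_crossing_density
  refine ⟨q, hq, (halvedPoints_isHalvedConfig.limit_le (N := 195) rfl hq).trans ?_, by norm_num⟩
  norm_num
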